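/- \textbf{Setting.} A semilattice is a commutative semigroup $E$ with a zero element $0$ in which $ee=e$ for all $e$; write $E^\times=E\setminus\{0\}$, and $e\le f$ if $ef=e$. Let $\mathbb{Z}[E^\times]$ be the free $\mathbb{Z}$-module on $E^\times$ with the ring multiplication that extends that of $E$, where the zero of $E$ is identified with the zero of the module; for $x\in\mathbb{Z}[E^\times]$ let $E(x)\subseteq E^\times$ be the set of basis elements with non-zero coefficient in $x$. For a finite $\mathcal R\subseteq E$ put $$\bigvee\mathcal R=\sum_{\varnothing\ne J\subseteq\mathcal R}(-1)^{|J|+1}\prod_{f\in J}f\in\mathbb{Z}[E^\times].$$ A finite cover for $e\in E^\times$ is a finite set $\mathcal R\subseteq E^\times$ with $f\le e$ for all $f\in\mathcal R$ such that every $f\in E^\times$ with $f\le e$ satisfies $ff'\ne0$ for some $f'\in\mathcal R$. Let $\Gamma$ be a group acting on $E$ by automorphisms $\tau_g$, and for each $e\in E^\times$ let $\mathscr R(e)$ be a set of finite covers for $e$ such that, with $(d\mathcal R)^\times=\{df: f\in\mathcal R\}\setminus\{0\}$: (i) if $d,e\in E^\times$, $de\ne0$ and $\mathcal R\in\mathscr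 R(e)$, then $de\in(d\mathcal R)^\times$ or $(d\mathcal R)^\times\in\mathscr R(de)$; (ii) if $e\in E^\times$, $\mathcal R_1,\dots,\mathcal R_r\in\mathscr R(e)$ are pairwise distinct and $\varepsilon_i\in E(\bigvee\mathcal R_i)$, then for every $j$ with $\prod_{i\ne j}\varepsilon_i\ne0$ (read as $e$ if $r=1$) one has $\prod_i\varepsilon_i\lneq\prod_{i\ne j}\varepsilon_i$; (iii) $\tau_g(\mathscr R(e))=\mathscr R(\tau_g(e))$ for all $g\in\Gamma$, $e\in E^\times$. Let $I$ be the ideal of $\mathbb{Z}[E^\times]$ generated by all $e-\bigvee\mathcal R$ with $e\in E^\times$, $\mathcal R\in\mathscr R(e)$. For $e\in E^\times$ and a non-empty finite $\mathscr S\subseteq\mathscr R(e)$ put $e(\mathscr S)=\prod_{\mathcal R\in\mathscr S}(e-\bigvee\mathcal R)\in\mathbb{Z}[E^\times]$, let $E(E,\mathscr R)$ be the set of all these $e(\mathscr S)$ together with $0$, with the multiplication and the $\Gamma$-action of $\mathbb{Z}[E^\times]$, and let $\mathscr R(E,\mathscr R)(e(\mathscr S))$ be the set of all $$\{e(\mathscr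 S\cup\{\tilde{\mathcal R}\})\}\cup\{f\cdot e(\mathscr S): f\in\tilde{\mathcal R},\ f\cdot e(\mathscr S)\ne0\},\qquad \tilde{\mathcal R}\in\mathscr R(e)\setminus\mathscr S.$$ Put $E_0=E$, $\mathscr R_0=\mathscr R$, $E_{k+1}=E(E_k,\mathscr R_k)$, $\mathscr R_{k+1}=\mathscr R(E_k,\mathscr R_k)$. An algebraic independent resolution of a commutative ring $D$ (not necessarily unital) that is generated by idempotents and carries a $\Gamma$-action is a $\Gamma$-equivariant exact sequence of ring homomorphisms $\cdots\to\mathbb{Z}[S_2^\times]\to\mathbb{Z}[S_1^\times]\to\mathbb{Z}[S_0^\times]\to D\to0$ with semilattices $S_k$ on which $\Gamma$ acts by automorphisms; its length is the smallest $n\ge0$ with $S_{n+1}=\{0\}$, and $\infty$ if there is none. \textbf{Statement.} Suppose that $\sup_{e\in E^\times}|\mathscr R(e)|<\infty$ (the supremum is $0$ if $E^\times=\varnothing$). Then: (a) All $E_k$ and $\mathscr R_k$ are well defined: for every $k$, $E_k$ is a semilattice with $\Gamma$-action and $\mathscr R_k$ is a well-defined family of sets of finite covers satisfying (i), (ii)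 and (iii). The elements $e(\mathscr S)\in E_{k+1}$ are non-zero and determine $e\in E_k^\times$ and $\mathscr S$. (b) Each step strictly decreases the number of covers: $|\mathscr R_{k+1}(e(\mathscr S))|<|\mathscr R_k(e)|$ for all $k\ge0$, $e\in E_k^\times$ and non-empty finite $\mathscr S\subseteq\mathscr R_k(e)$. (c) The canonical projection $\mathbb{Z}[E^\times]\to\mathbb{Z}[E^\times]/I$ and the homomorphisms $\mathbb{Z}[E_{k+1}^\times]\to\mathbb{Z}[E_k^\times]$ induced by the inclusions $E_{k+1}\subseteq\mathbb{Z}[E_k^\times]$ form an algebraic independent resolution $$\cdots\to\mathbb{Z}[E_2^\times]\to\mathbb{Z}[E_1^\times]\to\mathbb{Z}[E^\times]\to\mathbb{Z}[E^\times]/I\to0$$ of $\mathbb{Z}[E^\times]/I$ with the induced $\Gamma$-action. (d) The length of this resolution is at most $\sup_{e\in E^\times}|\mathscr R(e)|$. -/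

import Mathlib

universe u v w

noncomputable section

/-! ### The integral semigroup ring of the non-zero elements of a semilattice

A commutative idempotent semigroup with zero is the same thing as a meet-semilattice with a least
element: the product is `e ⊓ f`, the zero is `⊥`, and the natural partial order (`e f = e`) is
`e ≤ f`. -/

/-- The free `ℤ`-module on the set of non-zero elements of `E`; its multiplication is defined
below by `e · f = ef` if `ef ≠ 0` and `e · f = 0` otherwise. -/
def SemigroupRing (E : Type u) [SemilatticeInf E] [OrderBot E] : Type u :=
  {e : E // e ≠ ⊥} →₀ ℤ

namespace SemigroupRing

variable {E : Type u} [SemilatticeInf E] [OrderBot E]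

instance : AddCommGroup (SemigroupRing E) :=
  inferInstanceAs (AddCommGroup ({e : E // e ≠ ⊥} →₀ ℤ))

/-- The coefficients of an element of `ℤ[E^×]`. -/
def coeff : SemigroupRing E ≃+ ({e : E // e ≠ ⊥} →₀ ℤ) := AddEquiv.refl _

open Classical in
/-- The element of `ℤ[E^×]` given by `e ∈ E`: a basis vector if `e ≠ 0`, and `0` if `e = 0`. -/
def of (e : E) : SemigroupRing E :=
  coeff.symm (if h : e ≠ ⊥ then Finsupp.single ⟨e, h⟩ 1 else 0)

/-- The support `E(x)` of `x ∈ ℤ[E^×]`, as a subset of `E`. -/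
def supp (x : SemigroupRing E) : Set E :=
  {e | ∃ h : e ≠ ⊥, coeff x ⟨e, h⟩ ≠ 0}

/-- The additive map `∑ n_e e ↦ ∑ n_e f(e)`. -/
def liftAdd {A : Type w} [AddCommGroup A] (f : E → A) : SemigroupRing E →+ A :=
  (Finsupp.liftAddHom fun e : {e : E // e ≠ ⊥} => zmultiplesHom A (f e)).comp
    coeff.toAddMonoidHom

theorem of_bot : of (⊥ : E) = 0 := by
  unfold of
  rw [dif_neg (by simp), map_zero]

theorem of_ne {e : E} (h : e ≠ ⊥) : of e = coeff.symm (Finsupp.single ⟨e, h⟩ 1) := by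
  unfold of
  rw [dif_pos h]

theorem liftAdd_of {A : Type w} [AddCommGroup A] (f : E → A) (hf : f ⊥ = 0) (e : E) :
    liftAdd f (of e) = f e := by
  by_cases h : e = ⊥
  · subst h
    rw [of_bot, map_zero, hf]
  · rw [of_ne h]
    simp [liftAdd]

theorem addHom_ext {A : Type w} [AddCommGroup A] {φ ψ : SemigroupRing E →+ A}
    (h : ∀ e, φ (of e) = ψ (of e)) : φ = ψ := by
  have key : φ.comp coeff.symm.toAddMonoidHom = ψ.comp coeff.symm.toAddMonoidHom := by
    refine Finsupp.addHom_ext' fun e => ?_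
    ext
    have := h e.1
    rw [of_ne e.2] at this
    simpa using this
  refine AddMonoidHom.ext fun x => ?_
  simpa using DFunLike.congr_fun key (coeff x)

/-- The multiplication of `ℤ[E^×]` as a bi-additive map. -/
def mulHom : SemigroupRing E →+ SemigroupRing E →+ SemigroupRing E :=
  liftAdd fun e => liftAdd fun f => of (e ⊓ f)

theorem mulHom_of (e f : E) : mulHom (of e) (of f) = of (e ⊓ f) := by
  unfold mulHom
  rw [liftAdd_of, liftAdd_of]
  · simp [of_bot]
  · refine addHom_ext fun f => ?_
    rw [liftAdd_of _ (by simp [of_bot])]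
    simp [of_bot]

instance : Mul (SemigroupRing E) := ⟨fun x y => mulHom x y⟩

theorem mul_eq_mulHom (x y : SemigroupRing E) : x * y = mulHom x y := rfl

theorem of_mul_of (e f : E) : of e * of f = of (e ⊓ f) := mulHom_of e f

theorem induction_of {p : SemigroupRing E → Prop} (x : SemigroupRing E) (h0 : p 0)
    (hof : ∀ e, p (of e)) (hadd : ∀ x y, p x → p y → p (x + y)) (hneg : ∀ x, p x → p (-x)) :
    p x := by
  let K : AddSubgroup (SemigroupRing E) :=
    { carrier := {x | p x}
      zero_mem' := h0
      add_mem' := fun {a b} ha hb => hadd a b ha hb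
      neg_mem' := fun {a} ha => hneg a ha }
  have h : QuotientAddGroup.mk' K = 0 := by
    refine addHom_ext fun e => ?_
    exact (QuotientAddGroup.eq_zero_iff _).2 (hof e)
  have hx : QuotientAddGroup.mk' K x = 0 := by rw [h]; rfl
  exact (QuotientAddGroup.eq_zero_iff x).1 hx

instance : NonUnitalCommRing (SemigroupRing E) where
  left_distrib x y z := by simp only [mul_eq_mulHom, map_add]
  right_distrib x y z := by simp only [mul_eq_mulHom, map_add, AddMonoidHom.add_apply]
  zero_mul x := by simp only [mul_eq_mulHom, map_zero, AddMonoidHom.zero_apply]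
  mul_zero x := by simp only [mul_eq_mulHom, map_zero]
  mul_assoc x y z := by
    simp only [mul_eq_mulHom]
    induction x using induction_of with
    | h0 => simp
    | hadd a b ha hb => simp [ha, hb]
    | hneg a ha => simp [ha]
    | hof a =>
      induction y using induction_of with
      | h0 => simp
      | hadd a b ha hb => simp [ha, hb]
      | hneg a ha => simp [ha]
      | hof b =>
        induction z using induction_of with
        | h0 => simp
        | hadd a b ha hb => simp [ha, hb]
        | hneg a ha => simp [ha]
        | hof c => simp [mulHom_of, inf_assoc]
  mul_comm x y := by
    simp only [mul_eq_mulHom]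
    induction x using induction_of with
    | h0 => simp
    | hadd a b ha hb => simp [ha, hb]
    | hneg a ha => simp [ha]
    | hof a =>
      induction y using induction_of with
      | h0 => simp
      | hadd a b ha hb => simp [ha, hb]
      | hneg a ha => simp [ha]
      | hof b => simp [mulHom_of, inf_comm]

/-- The universal property: a multiplicative zero-preserving map `f` from `E` to a ring (whose
values are then idempotents) extends to a homomorphism of (non-unital) rings with `e ↦ f(e)`. -/
def lift {A : Type w} [NonUnitalCommRing A] (f : E → A) (h0 : f ⊥ = 0)
    (hmul : ∀ d e, f (d ⊓ e) = f d * f e) : SemigroupRing E →ₙ+* A :=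
  { liftAdd f with
    map_mul' := fun x y => by
      change liftAdd f (x * y) = liftAdd f x * liftAdd f y
      induction x using induction_of with
      | h0 => simp
      | hadd a b ha hb => simp [add_mul, ha, hb]
      | hneg a ha => simp [ha]
      | hof a =>
        induction y using induction_of with
        | h0 => simp
        | hadd a b ha hb => simp [mul_add, ha, hb]
        | hneg a ha => simp [ha]
        | hof b => rw [of_mul_of, liftAdd_of f h0, liftAdd_of f h0, liftAdd_of f h0, hmul] }

theorem lift_of {A : Type w} [NonUnitalCommRing A] (f : E → A) (h0 : f ⊥ = 0)
    (hmul : ∀ d e, f (d ⊓ e) = f d * f e) (e : E) : lift f h0 hmul (of e) = f e :=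
  liftAdd_of f h0 e

theorem hom_ext {A : Type w} [NonUnitalCommRing A] {φ ψ : SemigroupRing E →ₙ+* A}
    (h : ∀ e, φ (of e) = ψ (of e)) (x : SemigroupRing E) : φ x = ψ x :=
  DFunLike.congr_fun (addHom_ext (φ := φ.toAddMonoidHom) (ψ := ψ.toAddMonoidHom) h) x

/-- The ring homomorphism induced by an automorphism of `E`. -/
def mapIso (σ : E ≃o E) : SemigroupRing E →ₙ+* SemigroupRing E :=
  lift (fun e => of (σ e)) (by simp [of_bot]) (by simp [of_mul_of])

theorem mapIso_of (σ : E ≃o E) (e : E) : mapIso σ (of e) = of (σ e) := lift_of _ _ _ e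

theorem mapIso_mul (σ τ : E ≃o E) (x : SemigroupRing E) :
    mapIso (σ * τ) x = mapIso σ (mapIso τ x) :=
  hom_ext (φ := mapIso (σ * τ)) (ψ := (mapIso σ).comp (mapIso τ))
    (fun e => by simp [mapIso_of]) x

theorem mapIso_one (x : SemigroupRing E) : mapIso (1 : E ≃o E) x = x :=
  hom_ext (φ := mapIso (1 : E ≃o E)) (ψ := NonUnitalRingHom.id _) (fun e => by simp [mapIso_of]) x

/-- Automorphisms of `E` act on `ℤ[E^×]` by ring automorphisms. -/
def mapAut : (E ≃o E) →* RingAut (SemigroupRing E) where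
  toFun σ :=
    { toFun := mapIso σ
      invFun := mapIso σ⁻¹
      left_inv := fun x => by rw [← mapIso_mul, inv_mul_cancel, mapIso_one]
      right_inv := fun x => by rw [← mapIso_mul, mul_inv_cancel, mapIso_one]
      map_mul' := map_mul _
      map_add' := map_add _ }
  map_one' := RingEquiv.ext mapIso_one
  map_mul' σ τ := RingEquiv.ext (mapIso_mul σ τ)

theorem mapAut_of (σ : E ≃o E) (e : E) : mapAut σ (of e) = of (σ e) := mapIso_of σ e

/-- `⋁ F = ∑_{∅ ≠ J ⊆ F} (-1)^{|J|+1} ∏_{f ∈ J} f`, the smallest idempotent of `ℤ[E^×]` dominating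
all elements of the finite set `F ⊆ E`. -/
def join (F : Finset E) : SemigroupRing E :=
  ∑ J ∈ F.powerset, if h : J.Nonempty then (-1 : ℤ) ^ (J.card + 1) • of (J.inf' h id) else 0

theorem mapAut_join (σ : E ≃o E) (F : Finset E) :
    mapAut σ (join F) = join (F.map σ.toEquiv.toEmbedding) := by
  unfold join
  rw [map_sum]
  refine Finset.sum_bij (fun J _ => J.map σ.toEquiv.toEmbedding) ?_ ?_ ?_ ?_
  · intro J hJ
    simp only [Finset.mem_powerset] at hJ ⊢
    exact Finset.map_subset_map.2 hJ
  · intro J _ K _ h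
    exact Finset.map_injective _ h
  · intro K hK
    rw [Finset.mem_powerset, Finset.subset_map_iff] at hK
    obtain ⟨J, hJ, rfl⟩ := hK
    exact ⟨J, Finset.mem_powerset.2 hJ, rfl⟩
  · intro J _
    by_cases h : J.Nonempty
    · rw [dif_pos h, dif_pos (by simpa using h), map_zsmul, mapAut_of, Finset.card_map]
      congr 2
      rw [Finset.inf'_map, map_finset_inf']
      rfl
    · rw [dif_neg h, dif_neg (by simpa using h), map_zero]

/-- `e(𝒮) = ∏_{F ∈ 𝒮} (e - ⋁ F)`. The product is formed starting from `e`, which makes no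
difference when `𝒮` is a non-empty set of covers of `e`, because then `e (e - ⋁ F) = e - ⋁ F`. -/
def prodElt (e : E) (S : Finset (Finset E)) : SemigroupRing E :=
  S.fold (· * ·) (of e) fun F => of e - join F

theorem mapAut_prodElt (σ : E ≃o E) (e : E) (S : Finset (Finset E)) :
    mapAut σ (prodElt e S) =
      prodElt (σ e) (S.map (Finset.mapEmbedding σ.toEquiv.toEmbedding).toEmbedding) := by
  unfold prodElt
  rw [Finset.fold_map, ← mapAut_of,
    ← Finset.fold_hom (op := (· * ·)) (m := mapAut σ) (fun x y => map_mul _ x y)]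
  refine Finset.fold_congr fun F _ => ?_
  simp [mapAut_join, mapAut_of]

end SemigroupRing

open SemigroupRing

/-! ### Independent resolutions -/

/-- A `Γ`-semilattice: a semilattice with zero on which `Γ` acts by automorphisms. -/
structure GSemilattice (Γ : Type v) [Group Γ] where
  /-- the underlying set -/
  E : Type u
  [semilatticeInf : SemilatticeInf E]
  [orderBot : OrderBot E]
  /-- the action -/
  τ : Γ →* (E ≃o E)

attribute [instance] GSemilattice.semilatticeInf GSemilattice.orderBot

/-- The action of `Γ` on `ℤ[E^×]` induced by the action on `E`. -/
def GSemilattice.ringAction {Γ : Type v} [Group Γ] (X : GSemilattice.{u} Γ) :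
    Γ →* RingAut (SemigroupRing X.E) :=
  mapAut.comp X.τ

/-- The `Γ`-semilattices `S 0, S 1, …` together with the homomorphisms `aug` and `d k` form an
algebraic independent resolution
`⋯ → ℤ[(S 2)^×] → ℤ[(S 1)^×] → ℤ[(S 0)^×] → D → 0`
of the commutative ring `D`, which is generated by idempotents and carries the action `σ`. -/
structure IsIndependentResolution {Γ : Type v} [Group Γ] {D : Type w} [NonUnitalCommRing D]
    (σ : Γ →* RingAut D) (S : ℕ → GSemilattice.{u} Γ) (aug : SemigroupRing (S 0).E →ₙ+* D)
    (d : ∀ k, SemigroupRing (S (k + 1)).E →ₙ+* SemigroupRing (S k).E) : Prop where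
  generated : NonUnitalSubring.closure {a : D | IsIdempotentElem a} = ⊤
  aug_equivariant : ∀ g x, aug ((S 0).ringAction g x) = σ g (aug x)
  d_equivariant : ∀ k g x, d k ((S (k + 1)).ringAction g x) = (S k).ringAction g (d k x)
  aug_surjective : Function.Surjective aug
  exact_zero : Function.Exact (d 0) aug
  exact_succ : ∀ k, Function.Exact (d (k + 1)) (d k)

/-- The length of an independent resolution: the least `n ≥ 0` with `S (n + 1) = {0}`, and `∞` if
there is none. -/
def resolutionLength {Γ : Type v} [Group Γ] (S : ℕ → GSemilattice.{u} Γ) : ℕ∞ :=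
  ⨅ n ∈ {n : ℕ | ∀ x : (S (n + 1)).E, x = ⊥}, (n : ℕ∞)

/-! ### Systems of finite covers -/

section Covers

variable {E : Type u} [SemilatticeInf E] [OrderBot E]

/-- `F` is a finite cover for `e`. -/
def IsFiniteCover (e : E) (F : Finset E) : Prop :=
  (∀ f ∈ F, f ≠ ⊥ ∧ f ≤ e) ∧ ∀ f, f ≠ ⊥ → f ≤ e → ∃ f' ∈ F, f ⊓ f' ≠ ⊥

open Classical in
/-- `(d · F)^×`, the set of non-zero elements of `d · F`. -/
def mulCover (d : E) (F : Finset E) : Finset E :=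
  (F.image fun f => d ⊓ f).filter fun f => f ≠ ⊥

/-- `e · ∏_{i ∈ s} ε i`. -/
def infBelow {ι : Type w} (e : E) (s : Finset ι) (ε : ι → E) : E :=
  s.fold (· ⊓ ·) e ε

end Covers

/-- A `Γ`-semilattice `E` with a `Γ`-invariant family of sets `ℛ(e)` of finite subsets of `E`,
for `e ≠ 0` in `E` (the value of `ℛ` at `0` plays no role). -/
structure CoverSystem (Γ : Type v) [Group Γ] extends GSemilattice.{u} Γ where
  /-- the sets of finite subsets -/
  R : E → Set (Finset E)
  /-- condition (iii): `τ_g (ℛ(e)) = ℛ(τ_g(e))` -/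
  R_equivariant : ∀ (g : Γ) (e : E), e ≠ ⊥ →
    (fun F : Finset E => F.map (τ g).toEquiv.toEmbedding) '' R e = R (τ g e)

namespace CoverSystem

variable {Γ : Type v} [Group Γ] (X : CoverSystem.{u} Γ)

open Classical in
/-- `ℛ` is a collection of finite covers for `E` satisfying (i) and (ii); together with
`R_equivariant` this is the complete list of standing assumptions. In (ii) the pairwise distinct
covers are the elements of a finite set `S`, and `e · ∏` is the product `∏` if that is
non-empty (all `ε F` lie below `e`) and `e` otherwise. -/
structure Admissible : Prop where
  isFiniteCover : ∀ e, e ≠ ⊥ → ∀ F ∈ X.R e, IsFiniteCover e F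
  cond_i : ∀ d e, d ≠ ⊥ → e ≠ ⊥ → d ⊓ e ≠ ⊥ → ∀ F ∈ X.R e,
    d ⊓ e ∈ mulCover d F ∨ mulCover d F ∈ X.R (d ⊓ e)
  cond_ii : ∀ e, e ≠ ⊥ → ∀ S : Finset (Finset X.E), (S : Set (Finset X.E)) ⊆ X.R e →
    ∀ ε : Finset X.E → X.E, (∀ F ∈ S, ε F ∈ supp (join F)) →
    ∀ G ∈ S, infBelow e (S.erase G) ε ≠ ⊥ → infBelow e S ε < infBelow e (S.erase G) ε

/-- The ideal `I` of `ℤ[E^×]` generated by all `e - ⋁ F`, `e ∈ E^×`, `F ∈ ℛ(e)`. -/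
def relIdeal : TwoSidedIdeal (SemigroupRing X.E) :=
  TwoSidedIdeal.span {x | ∃ e, e ≠ ⊥ ∧ ∃ F ∈ X.R e, x = of e - join F}

/-- The quotient ring `ℤ[E^×] / I`. -/
abbrev QuotRing : Type u := X.relIdeal.ringCon.Quotient

/-- The canonical projection `ℤ[E^×] → ℤ[E^×] / I`. -/
def proj : SemigroupRing X.E →ₙ+* X.QuotRing where
  toFun x := (x : X.relIdeal.ringCon.Quotient)
  map_mul' _ _ := rfl
  map_zero' := rfl
  map_add' _ _ := rfl

theorem ringAction_mem_relIdeal (g : Γ) {x : SemigroupRing X.E} (hx : x ∈ X.relIdeal) :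
    X.ringAction g x ∈ X.relIdeal := by
  have h : X.relIdeal ≤ X.relIdeal.comap (X.ringAction g) := by
    refine TwoSidedIdeal.span_le.2 ?_
    rintro _ ⟨e, he, F, hF, rfl⟩
    refine (TwoSidedIdeal.mem_comap _).2 (TwoSidedIdeal.subset_span ?_)
    refine ⟨X.τ g e, by simpa using he, F.map (X.τ g).toEquiv.toEmbedding, ?_, ?_⟩
    · rw [← X.R_equivariant g e he]
      exact ⟨F, hF, rfl⟩
    · rw [map_sub]
      exact congrArg₂ _ (mapAut_of _ _) (mapAut_join _ _)
  exact (TwoSidedIdeal.mem_comap _).1 (h hx)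

theorem ringCon_ringAction (g : Γ) {x y : SemigroupRing X.E} (h : X.relIdeal.ringCon x y) :
    X.relIdeal.ringCon (X.ringAction g x) (X.ringAction g y) := by
  rw [TwoSidedIdeal.rel_iff] at h ⊢
  rw [← map_sub]
  exact X.ringAction_mem_relIdeal g h

/-- The map induced by `g ∈ Γ` on `ℤ[E^×] / I`. -/
def quotMap (g : Γ) : X.QuotRing → X.QuotRing :=
  Quotient.map' (X.ringAction g) fun _ _ h => X.ringCon_ringAction g h

/-- The action of `Γ` on `ℤ[E^×] / I` induced by the action on `E`. -/
def quotAction : Γ →* RingAut X.QuotRing where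
  toFun g :=
    { toFun := X.quotMap g
      invFun := X.quotMap g⁻¹
      left_inv := by
        rintro ⟨x⟩
        refine congrArg X.proj ?_
        rw [← RingAut.mul_apply, ← map_mul, inv_mul_cancel, map_one, RingAut.one_apply]
      right_inv := by
        rintro ⟨x⟩
        refine congrArg X.proj ?_
        rw [← RingAut.mul_apply, ← map_mul, mul_inv_cancel, map_one, RingAut.one_apply]
      map_mul' := by
        rintro ⟨x⟩ ⟨y⟩
        exact congrArg X.proj (map_mul (X.ringAction g) x y)
      map_add' := by
        rintro ⟨x⟩ ⟨y⟩
        exact congrArg X.proj (map_add (X.ringAction g) x y) }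
  map_one' := by
    refine RingEquiv.ext ?_
    rintro ⟨x⟩
    refine congrArg X.proj ?_
    rw [map_one, RingAut.one_apply]
  map_mul' g h := by
    refine RingEquiv.ext ?_
    rintro ⟨x⟩
    refine congrArg X.proj ?_
    rw [map_mul, RingAut.mul_apply]

/-! ### The derived system of covers -/

/-- The set `{e(𝒮) | e ∈ E^×, ∅ ≠ 𝒮 ⊆ ℛ(e) finite} ∪ {0}`. -/
def nextSet : Set (SemigroupRing X.E) :=
  {x | ∃ e, e ≠ ⊥ ∧ ∃ S : Finset (Finset X.E), S.Nonempty ∧ (S : Set (Finset X.E)) ⊆ X.R e ∧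
    x = prodElt e S} ∪ {0}

/-- The semigroup of idempotents in the semigroup generated by `nextSet`. For an admissible system
it is equal to `nextSet`; this is part of `WellDefined` below. -/
def nextSemigroup : Subsemigroup (SemigroupRing X.E) where
  carrier := {x | x ∈ Subsemigroup.closure X.nextSet ∧ IsIdempotentElem x}
  mul_mem' := fun ha hb => ⟨mul_mem ha.1 hb.1, ha.2.mul hb.2⟩

/-- The semilattice `E(E, ℛ)`, with the multiplication of `ℤ[E^×]`. -/
def Next : Type u := {x : SemigroupRing X.E // x ∈ X.nextSemigroup}

/-- The inclusion of `E(E, ℛ)` in the set of idempotents of `ℤ[E^×]`. -/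
def incl (x : X.Next) : SemigroupRing X.E := x.1

theorem incl_injective : Function.Injective X.incl := Subtype.val_injective

instance : Min X.Next := ⟨fun x y => ⟨x.1 * y.1, mul_mem x.2 y.2⟩⟩

instance : SemilatticeInf X.Next :=
  SemilatticeInf.mk' (fun x y => Subtype.ext (mul_comm x.1 y.1))
    (fun x y z => Subtype.ext (mul_assoc x.1 y.1 z.1)) (fun x => Subtype.ext x.2.2)

theorem incl_inf (x y : X.Next) : X.incl (x ⊓ y) = X.incl x * X.incl y := rfl

theorem next_le_iff (x y : X.Next) : x ≤ y ↔ X.incl x * X.incl y = X.incl x := by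
  rw [← inf_eq_left, ← X.incl_inf, X.incl_injective.eq_iff]

instance : OrderBot X.Next where
  bot := ⟨0, Subsemigroup.subset_closure (Or.inr rfl), zero_mul 0⟩
  bot_le _ := (X.next_le_iff _ _).2 (zero_mul _)

theorem incl_bot : X.incl ⊥ = 0 := rfl

theorem mem_map_R (g : Γ) {e : X.E} (he : e ≠ ⊥) {F : Finset X.E} (hF : F ∈ X.R e) :
    F.map (X.τ g).toEquiv.toEmbedding ∈ X.R (X.τ g e) := by
  rw [← X.R_equivariant g e he]
  exact ⟨F, hF, rfl⟩

theorem map_subset_R (g : Γ) {e : X.E} (he : e ≠ ⊥) {S : Finset (Finset X.E)}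
    (hS : (S : Set (Finset X.E)) ⊆ X.R e) :
    ((S.map (Finset.mapEmbedding (X.τ g).toEquiv.toEmbedding).toEmbedding :
      Finset (Finset X.E)) : Set (Finset X.E)) ⊆ X.R (X.τ g e) := by
  intro F hF
  simp only [Finset.coe_map, Set.mem_image] at hF
  obtain ⟨G, hG, rfl⟩ := hF
  exact X.mem_map_R g he (hS hG)

theorem ringAction_prodElt (g : Γ) (e : X.E) (S : Finset (Finset X.E)) :
    X.ringAction g (prodElt e S) = prodElt (X.τ g e)
      (S.map (Finset.mapEmbedding (X.τ g).toEquiv.toEmbedding).toEmbedding) :=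
  mapAut_prodElt _ _ _

theorem ringAction_mem_nextSet (g : Γ) {x : SemigroupRing X.E} (hx : x ∈ X.nextSet) :
    X.ringAction g x ∈ X.nextSet := by
  rcases hx with ⟨e, he, S, hS, hSR, rfl⟩ | hx
  · refine Or.inl ⟨X.τ g e, by simpa using he, _, by simpa using hS, X.map_subset_R g he hSR,
      X.ringAction_prodElt g e S⟩
  · rw [Set.mem_singleton_iff] at hx
    rw [hx, map_zero]
    exact Or.inr rfl

theorem ringAction_mem_next (g : Γ) {x : SemigroupRing X.E} (hx : x ∈ X.nextSemigroup) :
    X.ringAction g x ∈ X.nextSemigroup := by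
  refine ⟨?_, ?_⟩
  · have h : Subsemigroup.closure X.nextSet ≤
        (Subsemigroup.closure X.nextSet).comap (X.ringAction g).toMulEquiv.toMulHom :=
      Subsemigroup.closure_le.2 fun y hy =>
        Subsemigroup.subset_closure (X.ringAction_mem_nextSet g hy)
    exact h hx.1
  · have := hx.2
    unfold IsIdempotentElem at this ⊢
    rw [← map_mul, this]

/-- The map of `E(E, ℛ)` given by the restriction of the action of `g` on `ℤ[E^×]`. -/
def nextMap (g : Γ) (x : X.Next) : X.Next := ⟨X.ringAction g x.1, X.ringAction_mem_next g x.2⟩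

theorem incl_nextMap (g : Γ) (x : X.Next) : X.incl (X.nextMap g x) = X.ringAction g (X.incl x) :=
  rfl

theorem nextMap_mul (g h : Γ) (x : X.Next) : X.nextMap (g * h) x = X.nextMap g (X.nextMap h x) := by
  apply X.incl_injective
  rw [incl_nextMap, incl_nextMap, incl_nextMap, map_mul, RingAut.mul_apply]

theorem nextMap_one (x : X.Next) : X.nextMap 1 x = x := by
  apply X.incl_injective
  rw [incl_nextMap, map_one, RingAut.one_apply]

/-- The action of `Γ` on `E(E, ℛ)`. -/
def nextAction : Γ →* (X.Next ≃o X.Next) where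
  toFun g :=
    { toFun := X.nextMap g
      invFun := X.nextMap g⁻¹
      left_inv := fun x => by rw [← nextMap_mul, inv_mul_cancel, nextMap_one]
      right_inv := fun x => by rw [← nextMap_mul, mul_inv_cancel, nextMap_one]
      map_rel_iff' := by
        intro x y
        change X.nextMap g x ≤ X.nextMap g y ↔ x ≤ y
        rw [next_le_iff, next_le_iff, incl_nextMap, incl_nextMap, ← map_mul,
          (X.ringAction g).injective.eq_iff] }
  map_one' := RelIso.ext X.nextMap_one
  map_mul' g h := RelIso.ext (X.nextMap_mul g h)

theorem incl_nextAction (g : Γ) (x : X.Next) :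
    X.incl (X.nextAction g x) = X.ringAction g (X.incl x) := rfl

open Classical in
/-- The set `ℛ(𝒮, G) = {e(𝒮 ∪ {G})} ∪ {f · e(𝒮) | f ∈ G, f · e(𝒮) ≠ 0}`. -/
def nextCover (e : X.E) (S : Finset (Finset X.E)) (G : Finset X.E) : Set (SemigroupRing X.E) :=
  {prodElt e (insert G S)} ∪ {y | y ≠ 0 ∧ ∃ f ∈ G, y = of f * prodElt e S}

/-- The family `ℛ(E, ℛ)`: the sets assigned to `e(𝒮)` are the `ℛ(𝒮, G)` with `G ∈ ℛ(e) \ 𝒮`. -/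
def nextR (x : X.Next) : Set (Finset X.Next) :=
  {T | ∃ e, e ≠ ⊥ ∧ ∃ S : Finset (Finset X.E), S.Nonempty ∧ (S : Set (Finset X.E)) ⊆ X.R e ∧
    ∃ G ∈ X.R e, G ∉ S ∧ X.incl x = prodElt e S ∧ X.incl '' (T : Set X.Next) = X.nextCover e S G}

theorem ringAction_nextCover (g : Γ) (e : X.E) (S : Finset (Finset X.E)) (G : Finset X.E) :
    X.ringAction g '' X.nextCover e S G = X.nextCover (X.τ g e)
      (S.map (Finset.mapEmbedding (X.τ g).toEquiv.toEmbedding).toEmbedding)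
      (G.map (X.τ g).toEquiv.toEmbedding) := by
  classical
  unfold nextCover
  rw [Set.image_union, Set.image_singleton, ringAction_prodElt]
  congr 1
  · rw [Finset.map_insert]
    rfl
  · ext y
    constructor
    · rintro ⟨z, ⟨hz, f, hf, rfl⟩, rfl⟩
      refine ⟨?_, X.τ g f, ?_, ?_⟩
      · exact (map_ne_zero_iff _ (X.ringAction g).injective).2 hz
      · exact Finset.mem_map_of_mem _ hf
      · rw [map_mul, ringAction_prodElt]
        exact congrArg (· * _) (mapAut_of _ _)
    · rintro ⟨hy, f', hf', rfl⟩
      obtain ⟨f, hf, rfl⟩ := Finset.mem_map.1 hf'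
      have key : X.ringAction g (of f * prodElt e S) = of (X.τ g f) * prodElt (X.τ g e)
          (S.map (Finset.mapEmbedding (X.τ g).toEquiv.toEmbedding).toEmbedding) := by
        rw [map_mul, ringAction_prodElt]
        exact congrArg (· * _) (mapAut_of _ _)
      refine ⟨of f * prodElt e S, ⟨?_, f, hf, rfl⟩, key⟩
      intro h0
      rw [h0, map_zero] at key
      exact hy key.symm

theorem map_mem_nextR (g : Γ) (x : X.Next) {T : Finset X.Next} (hT : T ∈ X.nextR x) :
    T.map (X.nextAction g).toEquiv.toEmbedding ∈ X.nextR (X.nextAction g x) := by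
  obtain ⟨e, he, S, hS, hSR, G, hG, hGS, hx, hT⟩ := hT
  refine ⟨X.τ g e, by simpa using he, _, by simpa using hS, X.map_subset_R g he hSR,
    G.map (X.τ g).toEquiv.toEmbedding, X.mem_map_R g he hG, ?_, ?_, ?_⟩
  · intro h
    obtain ⟨G', hG', h⟩ := Finset.mem_map.1 h
    exact hGS (Finset.map_injective _ h ▸ hG')
  · rw [incl_nextAction, hx, ringAction_prodElt]
  · rw [← ringAction_nextCover, ← hT, Finset.coe_map, Set.image_image, Set.image_image]
    rfl

/-- The derived system `(E(E, ℛ), ℛ(E, ℛ))`. -/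
def next : CoverSystem.{u} Γ where
  E := X.Next
  τ := X.nextAction
  R := X.nextR
  R_equivariant := by
    intro g x _
    refine Set.Subset.antisymm ?_ ?_
    · rintro _ ⟨T, hT, rfl⟩
      exact X.map_mem_nextR g x hT
    · intro T hT
      have h := X.map_mem_nextR g⁻¹ _ hT
      rw [← RelIso.mul_apply, ← map_mul, inv_mul_cancel, map_one, RelIso.one_apply] at h
      refine ⟨_, h, ?_⟩
      change (T.map (X.nextAction g⁻¹).toEquiv.toEmbedding).map
        (X.nextAction g).toEquiv.toEmbedding = T
      rw [Finset.map_map]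
      convert Finset.map_refl
      ext y
      change X.nextAction g (X.nextAction g⁻¹ y) = y
      rw [← RelIso.mul_apply, ← map_mul, mul_inv_cancel, map_one, RelIso.one_apply]

/-- The homomorphism `ℤ[E(E, ℛ)^×] → ℤ[E^×]` induced by the inclusion. -/
def nextHom : SemigroupRing X.next.E →ₙ+* SemigroupRing X.E :=
  lift X.incl X.incl_bot X.incl_inf

/-- The systems `(E_k, ℛ_k)`: `E_0 = E`, `ℛ_0 = ℛ`, `E_{k+1} = E(E_k, ℛ_k)`,
`ℛ_{k+1} = ℛ(E_k, ℛ_k)`. -/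
def iter : ℕ → CoverSystem.{u} Γ
  | 0 => X
  | k + 1 => (iter k).next

/-- The derived system is well defined as described: `E(E, ℛ)` is exactly `nextSet`, the elements
`e(𝒮)` are non-zero and determine `e` and `𝒮`, and the sets `ℛ(𝒮, G)` are contained in
`E(E, ℛ)`. Consequently `nextR (e(𝒮)) = {ℛ(𝒮, G) | G ∈ ℛ(e) \ 𝒮}`. -/
structure WellDefined : Prop where
  carrier_eq : (X.nextSemigroup : Set (SemigroupRing X.E)) = X.nextSet
  prodElt_ne_zero : ∀ e, e ≠ ⊥ → ∀ S : Finset (Finset X.E), S.Nonempty →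
    (S : Set (Finset X.E)) ⊆ X.R e → prodElt e S ≠ 0
  prodElt_injective : ∀ d e, d ≠ ⊥ → e ≠ ⊥ → ∀ S T : Finset (Finset X.E), S.Nonempty →
    T.Nonempty → (S : Set (Finset X.E)) ⊆ X.R d → (T : Set (Finset X.E)) ⊆ X.R e →
    prodElt d S = prodElt e T → d = e ∧ S = T
  nextCover_subset : ∀ e, e ≠ ⊥ → ∀ S : Finset (Finset X.E), S.Nonempty →
    (S : Set (Finset X.E)) ⊆ X.R e → ∀ G ∈ X.R e, G ∉ S →
    X.nextCover e S G ⊆ (X.nextSemigroup : Set (SemigroupRing X.E))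

/-- `sup_{e ∈ E^×} |ℛ(e)|`. -/
def supCard : ℕ∞ := ⨆ e : {e : X.E // e ≠ ⊥}, (X.R e).encard

end CoverSystem

end

noncomputable section

open SemigroupRing

/-! ### Characters of the semigroup ring -/

namespace SemigroupRing

variable {E : Type u} [SemilatticeInf E] [OrderBot E]

/-! For non-zero `m`, the character `chi m` of `ℤ[E^×]` sends `d` to 1 if `m ≤ d` and to 0
otherwise. These characters separate points: at a maximal `m` of the support of `x`, the value of
`chi m` on `x` is the coefficient of `m` (`ext_chi`). So `e(𝒮)` can be treated as the indicator
function of the set of all `m ≤ e` that lie below no element of any cover in `𝒮` (`chi_prodElt`).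
Products become intersections, the order of `E(E, ℛ)` becomes inclusion, and most identities become
propositional logic.

Condition (ii) enters through one consequence, `not_infBelow_le`: a non-zero product of elements
from the supports of joins of some covers lies below no element of any further cover. With it, `e`
is the largest point of the set of `e(𝒮)`, and a maximal non-zero element of a cover outside `𝒮` is
again a point, so `e(𝒮)` determines `e` and `𝒮`. The same independence yields (ii) for the derived
system (`cond_ii_next`); there `join_cover` describes the joins of derived covers as disjoint sums.

For exactness, the image of `ℤ[E(E, ℛ)^×]` is an ideal containing the generators `e - ⋁ F = e({F})`,
hence it is `I`. The kernel is the ideal of relations of the derived system. These relations express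
`e(𝒮)` as `e(𝒮 ∪ {G})` plus terms belonging to strictly smaller elements of `E`. Inside a finite
multiplicatively closed set every element therefore reduces to a combination of the `e(T e)`, with
`T e` the largest available set of covers (`of_mem_of_relIdeal_le`). These are linearly independent
in `ℤ[E^×]`, by evaluating at a maximal `e` (`eq_zero_of_inclHom_eq_zero`). Applying the image
statement one level up gives exactness at every stage.

The covers of `e(𝒮)` inject into `ℛ(e) \ 𝒮`, so each step loses at least one cover, which bounds the
length. -/

theorem map_of_inf' {A : Type w} [CommRing A] (ψ : SemigroupRing E →ₙ+* A) {J : Finset E}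
    (h : J.Nonempty) : ψ (of (J.inf' h id)) = ∏ f ∈ J, ψ (of f) := by
  induction h using Finset.Nonempty.cons_induction with
  | singleton a => simp
  | cons a s ha hs ih =>
    rw [Finset.inf'_cons hs, ← of_mul_of, map_mul, ih, Finset.prod_cons]
    rfl

/-- Inclusion-exclusion. Since `ℤ[E^×]` need not have a unit, the formula is stated after applying a
homomorphism to a unital ring. -/
theorem one_sub_map_join {A : Type w} [CommRing A] (ψ : SemigroupRing E →ₙ+* A) (F : Finset E) :
    1 - ψ (join F) = ∏ f ∈ F, (1 - ψ (of f)) := by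
  classical
  simp only [sub_eq_add_neg (1 : A)]
  rw [Finset.prod_one_add, ← Finset.add_sum_erase _ _ (Finset.empty_mem_powerset F),
    Finset.prod_empty]
  congr 1
  unfold join
  rw [← Finset.add_sum_erase _ _ (Finset.empty_mem_powerset F), dif_neg (by simp), zero_add,
    map_sum, ← Finset.sum_neg_distrib]
  refine Finset.sum_congr rfl fun J hJ => ?_
  have hJ' : J.Nonempty := Finset.nonempty_iff_ne_empty.2 (Finset.ne_of_mem_erase hJ)
  rw [dif_pos hJ', map_zsmul, map_of_inf', Finset.prod_neg, pow_succ, zsmul_eq_mul]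
  push_cast
  ring

open Classical in
theorem map_join_of_zero_or_one {A : Type w} [CommRing A] [Nontrivial A]
    (ψ : SemigroupRing E →ₙ+* A) {F : Finset E}
    (h : ∀ f ∈ F, ψ (of f) = 0 ∨ ψ (of f) = 1) :
    ψ (join F) = if ∃ f ∈ F, ψ (of f) = 1 then 1 else 0 := by
  rw [← sub_sub_cancel 1 (ψ (join F)), one_sub_map_join]
  split_ifs with hex
  · obtain ⟨f, hf, hf1⟩ := hex
    rw [Finset.prod_eq_zero hf (by rw [hf1, sub_self]), sub_zero]
  · rw [Finset.prod_eq_one, sub_self]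
    intro f hf
    rw [(h f hf).resolve_right fun h1 => hex ⟨f, hf, h1⟩, sub_zero]

theorem map_prodElt {A : Type w} [CommRing A] (ψ : SemigroupRing E →ₙ+* A) (e : E)
    (S : Finset (Finset E)) :
    ψ (prodElt e S) = ψ (of e) * ∏ F ∈ S, (ψ (of e) - ψ (join F)) := by
  classical
  unfold prodElt
  induction S using Finset.induction_on with
  | empty => simp
  | insert F S hF ih =>
    rw [Finset.fold_insert hF, map_mul, ih, Finset.prod_insert hF, map_sub]
    ring

open Classical in
/-- The character of `ℤ[E^×]` that maps `d` to `1` if `m ≤ d` and to `0` otherwise. -/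
def chi (m : E) (hm : m ≠ ⊥) : SemigroupRing E →ₙ+* ℤ :=
  lift (fun d => if m ≤ d then 1 else 0) (by simp [hm])
    (fun d e => by by_cases h : m ≤ d <;> by_cases h' : m ≤ e <;> simp [h, h'])

open Classical in
theorem chi_of {m : E} (hm : m ≠ ⊥) (d : E) : chi m hm (of d) = if m ≤ d then 1 else 0 :=
  lift_of _ _ _ d

theorem liftAdd_apply {A : Type w} [AddCommGroup A] (f : E → A) (x : SemigroupRing E) :
    liftAdd f x = (coeff x).sum fun e n => n • f e := by
  simp [liftAdd, Finsupp.liftAddHom_apply]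
  rfl

theorem chi_eq_coeff {m : E} (hm : m ≠ ⊥) {x : SemigroupRing E}
    (h : ∀ d ∈ supp x, m ≤ d → d = m) : chi m hm x = coeff x ⟨m, hm⟩ := by
  classical
  have h1 : chi m hm x = (coeff x).sum fun e n => n • if m ≤ e.1 then (1 : ℤ) else 0 :=
    liftAdd_apply (fun e => if m ≤ e then 1 else 0) x
  rw [h1, Finsupp.sum]
  rw [Finset.sum_eq_single ⟨m, hm⟩]
  · simp
  · intro b hb hbm
    rw [if_neg, smul_zero]
    intro hmb
    exact hbm (Subtype.ext (h b.1 ⟨b.2, by simpa using hb⟩ hmb))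
  · intro hb
    simp only [Finsupp.mem_support_iff, not_not] at hb
    simp [hb]

theorem supp_finite (x : SemigroupRing E) : (supp x).Finite := by
  refine ((coeff x).support.finite_toSet.image Subtype.val).subset ?_
  rintro e ⟨he, h⟩
  exact ⟨⟨e, he⟩, by simpa using h, rfl⟩

theorem supp_nonempty {x : SemigroupRing E} (hx : x ≠ 0) : (supp x).Nonempty := by
  by_contra hne
  rw [Set.not_nonempty_iff_eq_empty] at hne
  apply hx
  apply coeff.injective
  rw [map_zero]
  ext ⟨e, he⟩
  by_contra h
  have : e ∈ supp x := ⟨he, h⟩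
  rw [hne] at this
  exact this

/-- At a maximal element of the support only that element contributes to its own character, so the
character value is a non-zero coefficient. -/
theorem eq_zero_of_chi {x : SemigroupRing E} (h : ∀ m hm, chi m hm x = 0) : x = 0 := by
  by_contra hx
  obtain ⟨m, hm, hmax⟩ := (supp_finite x).exists_maximal (supp_nonempty hx)
  have hm' := hm
  obtain ⟨hm0, hc⟩ := hm
  rw [← chi_eq_coeff hm0 fun d hd hmd => le_antisymm (hmax hd hmd) hmd] at hc
  exact hc (h m hm0)

theorem ext_chi {x y : SemigroupRing E} (h : ∀ m hm, chi m hm x = chi m hm y) : x = y :=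
  sub_eq_zero.1 (eq_zero_of_chi fun m hm => by rw [map_sub, h, sub_self])

open Classical in
theorem chi_join {m : E} (hm : m ≠ ⊥) (F : Finset E) :
    chi m hm (join F) = if ∃ f ∈ F, m ≤ f then 1 else 0 := by
  rw [map_join_of_zero_or_one]
  · simp [chi_of]
  · intro f _
    rw [chi_of]
    split_ifs <;> simp

-- This turns `e(𝒮)` into the indicator function of a set of points `m`; identities between such
-- products are checked pointwise from here on.
open Classical in
theorem chi_prodElt {m : E} (hm : m ≠ ⊥) (e : E) (S : Finset (Finset E)) :
    chi m hm (prodElt e S) = if m ≤ e ∧ ∀ F ∈ S, ∀ f ∈ F, ¬ m ≤ f then 1 else 0 := by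
  rw [map_prodElt, chi_of]
  by_cases h : m ≤ e
  · by_cases h' : ∀ F ∈ S, ∀ f ∈ F, ¬ m ≤ f
    · rw [if_pos h, if_pos ⟨h, h'⟩, one_mul, Finset.prod_eq_one]
      intro F hF
      rw [chi_join, if_neg, sub_zero]
      rintro ⟨f, hf, hmf⟩
      exact h' F hF f hf hmf
    · rw [if_pos h, if_neg (fun hh => h' hh.2), one_mul]
      push Not at h'
      obtain ⟨F, hF, hf⟩ := h'
      exact Finset.prod_eq_zero hF (by rw [chi_join, if_pos hf, sub_self])
  · rw [if_neg h, if_neg (fun hh : _ ∧ _ => h hh.1), zero_mul]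

/-! ### Supports -/

theorem supp_of_subset (e : E) : supp (of e) ⊆ {e} := by
  rintro d ⟨hd, h⟩
  by_contra hde
  by_cases he : e = ⊥
  · subst he
    rw [of_bot] at h
    simp at h
  · rw [of_ne he] at h
    apply h
    simp only [AddEquiv.apply_symm_apply]
    refine Finsupp.single_eq_of_ne ?_
    intro hh
    exact hde (by simpa using congrArg Subtype.val hh)

theorem supp_subset_iff_mem_closure {A : Set E} {x : SemigroupRing E} :
    supp x ⊆ A ↔ x ∈ AddSubgroup.closure (of '' A) := by
  constructor
  · intro h
    have hx : x = ∑ e ∈ (coeff x).support, coeff x e • of e.1 := by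
      apply coeff.injective
      rw [map_sum]
      conv_lhs => rw [← Finsupp.sum_single (coeff x)]
      refine Finset.sum_congr rfl fun e _ => ?_
      rw [map_zsmul, of_ne e.2]
      simp
    rw [hx]
    refine sum_mem fun e he => zsmul_mem (AddSubgroup.subset_closure
      (Set.mem_image_of_mem of (h ⟨e.2, ?_⟩))) _
    simpa using he
  · intro h
    induction h using AddSubgroup.closure_induction with
    | mem x hx =>
      obtain ⟨e, he, rfl⟩ := hx
      exact (supp_of_subset e).trans (by simpa using he)
    | zero => rintro d ⟨hd, h⟩; simp at h
    | add x y _ _ hx hy =>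
      rintro d ⟨hd, h⟩
      by_contra hdA
      apply h
      rw [map_add, Finsupp.add_apply]
      by_cases h1 : coeff x ⟨d, hd⟩ = 0
      · by_cases h2 : coeff y ⟨d, hd⟩ = 0
        · rw [h1, h2, add_zero]
        · exact (hdA (hy ⟨hd, h2⟩)).elim
      · exact (hdA (hx ⟨hd, h1⟩)).elim
    | neg x _ hx =>
      rintro d ⟨hd, h⟩
      refine hx ⟨hd, fun h0 => h ?_⟩
      rw [map_neg, Finsupp.neg_apply, h0, neg_zero]

theorem exists_le_of_mem_supp_join {F : Finset E} {d : E} (hd : d ∈ supp (join F)) :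
    ∃ f ∈ F, d ≤ f := by
  have h : supp (join F) ⊆ {d | ∃ f ∈ F, d ≤ f} := by
    rw [supp_subset_iff_mem_closure]
    refine sum_mem fun J hJ => ?_
    split_ifs with hne
    · refine zsmul_mem (AddSubgroup.subset_closure (Set.mem_image_of_mem of ?_)) _
      obtain ⟨f, hf⟩ := hne
      exact ⟨f, Finset.mem_powerset.1 hJ hf, Finset.inf'_le id hf⟩
    · exact zero_mem _
  exact h hd

/-- Everything in the support of the join lies below some element of `F`, so by maximality `chi m`
sees only the coefficient of `m`, and its value is 1. Cancellation can remove non-maximal elements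
of `F` from the support; hence condition (ii) is always fed with maximal ones. -/
theorem mem_supp_join_of_maximal {F : Finset E} {m : E} (hm : Maximal (· ∈ F) m) (h0 : m ≠ ⊥) :
    m ∈ supp (join F) := by
  refine ⟨h0, ?_⟩
  rw [← chi_eq_coeff h0, chi_join, if_pos ⟨m, hm.1, le_rfl⟩]
  · exact one_ne_zero
  · intro d hd hmd
    obtain ⟨f, hf, hdf⟩ := exists_le_of_mem_supp_join hd
    exact le_antisymm (hdf.trans (hm.2 hf (hmd.trans hdf))) hmd

end SemigroupRing

/-! ### Covers -/

section

variable {E : Type u} [SemilatticeInf E]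

theorem le_infBelow_iff {ι : Type w} {e d : E} {s : Finset ι} {ε : ι → E} :
    d ≤ infBelow e s ε ↔ d ≤ e ∧ ∀ i ∈ s, d ≤ ε i := by
  classical
  unfold infBelow
  induction s using Finset.induction_on with
  | empty => simp
  | insert a s ha ih =>
    rw [Finset.fold_insert ha, le_inf_iff, ih, Finset.forall_mem_insert]
    tauto

variable [OrderBot E]

theorem mem_mulCover {d x : E} {F : Finset E} :
    x ∈ mulCover d F ↔ x ≠ ⊥ ∧ ∃ f ∈ F, d ⊓ f = x := by
  simp [mulCover, and_comm]

open Classical in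
/-- The identity `d · e(𝒮) = (de)(d𝒮)`. -/
theorem of_mul_prodElt (d e : E) (S : Finset (Finset E)) :
    of d * prodElt e S = prodElt (d ⊓ e) (S.image (mulCover d)) := by
  refine ext_chi fun m hm => ?_
  rw [map_mul, chi_prodElt, chi_prodElt, chi_of, ite_zero_mul_ite_zero, one_mul]
  refine if_congr ?_ rfl rfl
  simp only [Finset.forall_mem_image, mem_mulCover, le_inf_iff]
  constructor
  · rintro ⟨h1, h2, h3⟩
    refine ⟨⟨h1, h2⟩, ?_⟩
    rintro F hF _ ⟨-, f, hf, rfl⟩ h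
    exact h3 F hF f hf (h.trans inf_le_right)
  · rintro ⟨⟨h1, h2⟩, h3⟩
    refine ⟨h1, h2, fun F hF f hf h => ?_⟩
    have : m ≤ d ⊓ f := le_inf h1 h
    exact h3 hF (d ⊓ f) ⟨fun h0 => hm (le_bot_iff.1 (h0 ▸ this)), f, hf, rfl⟩ this

open Classical in
theorem prodElt_union (e : E) (S T : Finset (Finset E)) :
    prodElt e (S ∪ T) = prodElt e S * prodElt e T := by
  refine ext_chi fun m hm => ?_
  rw [map_mul, chi_prodElt, chi_prodElt, chi_prodElt, ite_zero_mul_ite_zero, one_mul]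
  refine if_congr ?_ rfl rfl
  simp only [Finset.mem_union, or_imp, forall_and]
  tauto

open Classical in
theorem prodElt_mul_prodElt (d e : E) (S T : Finset (Finset E)) :
    prodElt d S * prodElt e T =
      prodElt (d ⊓ e) (S.image (mulCover e) ∪ T.image (mulCover d)) := by
  -- Each factor already lies below its own top element, so inserting `d` and `e` crosswise changes
  -- nothing.
  have h1 : prodElt d S * prodElt e T = of e * prodElt d S * (of d * prodElt e T) := by
    refine ext_chi fun m hm => ?_
    simp only [map_mul, chi_prodElt, chi_of, ite_zero_mul_ite_zero, one_mul]
    refine if_congr ?_ rfl rfl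
    tauto
  rw [h1, of_mul_prodElt, of_mul_prodElt, inf_comm e d, ← prodElt_union]

theorem isIdempotentElem_prodElt (e : E) (S : Finset (Finset E)) :
    IsIdempotentElem (prodElt e S) := by
  classical
  unfold IsIdempotentElem
  rw [← prodElt_union, Finset.union_idempotent]

end

namespace CoverSystem

variable {Γ : Type v} [Group Γ] {X : CoverSystem.{u, v} Γ}

/-! ### Independence of covers -/

namespace Admissible

/-- Enlarge `g` to a maximal `m ∈ G`. If the product were below `g`, adjoining `m` as the value at
`G` would leave it unchanged, against the strict inequality in (ii). -/
theorem not_infBelow_le (hX : X.Admissible) {e : X.E} (he : e ≠ ⊥) {S : Finset (Finset X.E)}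
    (hS : (S : Set (Finset X.E)) ⊆ X.R e) {ε : Finset X.E → X.E}
    (hε : ∀ F ∈ S, ε F ∈ supp (join F)) {G : Finset X.E} (hG : G ∈ X.R e) (hGS : G ∉ S)
    (h0 : infBelow e S ε ≠ ⊥) {g : X.E} (hg : g ∈ G) : ¬ infBelow e S ε ≤ g := by
  classical
  intro hle
  obtain ⟨m, hgm, hm⟩ := G.exists_le_maximal hg
  have hm0 : m ≠ ⊥ := ((hX.isFiniteCover e he G hG).1 m hm.1).1
  have hcongr : infBelow e S (Function.update ε G m) = infBelow e S ε :=
    Finset.fold_congr fun F hF => Function.update_of_ne (fun h => hGS (by rwa [← h])) _ _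
  have key := hX.cond_ii e he (insert G S)
    (by rw [Finset.coe_insert]; exact Set.insert_subset hG hS) (Function.update ε G m) (by
      intro F hF
      by_cases hFG : F = G
      · subst hFG
        rw [Function.update_self]
        exact mem_supp_join_of_maximal hm hm0
      · rw [Function.update_of_ne hFG]
        exact hε F (Finset.mem_of_mem_insert_of_ne hF hFG)) G (Finset.mem_insert_self _ _)
  rw [Finset.erase_insert hGS, hcongr] at key
  refine (key h0).not_ge ?_
  rw [le_infBelow_iff, Finset.forall_mem_insert, Function.update_self]
  rw [← hcongr] at hle ⊢
  exact ⟨(le_infBelow_iff.1 le_rfl).1, hle.trans hgm, (le_infBelow_iff.1 le_rfl).2⟩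

theorem not_le_of_mem (hX : X.Admissible) {e : X.E} (he : e ≠ ⊥) {G : Finset X.E}
    (hG : G ∈ X.R e) {g : X.E} (hg : g ∈ G) : ¬ e ≤ g := by
  -- With no covers the product is `e` itself, and the values of the choice function are irrelevant.
  have := hX.not_infBelow_le (S := ∅) (ε := fun _ => ⊥) he (by simp) (by simp) hG (by simp)
    (by simpa [infBelow] using he) hg
  simpa [infBelow] using this

theorem exists_mem_inf_ne_bot (hX : X.Admissible) {e : X.E} (he : e ≠ ⊥) {G : Finset X.E}
    (hG : G ∈ X.R e) {d : X.E} (hd : d ≠ ⊥) (hde : d ≤ e) :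
    ∃ g, Maximal (· ∈ G) g ∧ d ⊓ g ≠ ⊥ := by
  obtain ⟨f, hf, hdf⟩ := (hX.isFiniteCover e he G hG).2 d hd hde
  obtain ⟨g, hfg, hg⟩ := G.exists_le_maximal hf
  exact ⟨g, hg, fun h => hdf (le_bot_iff.1 (h ▸ inf_le_inf_left d hfg))⟩

/-! ### The elements `e(𝒮)` -/

/-- No element of a cover of `e` lies above `e`, so `e` is a point of the set of `e(𝒮)`, necessarily
the largest. This lets `e` be recovered from `e(𝒮)`. -/
theorem chi_self_prodElt (hX : X.Admissible) {e : X.E} (he : e ≠ ⊥) {S : Finset (Finset X.E)}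
    (hS : (S : Set (Finset X.E)) ⊆ X.R e) : chi e he (prodElt e S) = 1 := by
  rw [chi_prodElt, if_pos]
  exact ⟨le_rfl, fun F hF f hf => hX.not_le_of_mem he (hS hF) hf⟩

theorem prodElt_ne_zero (hX : X.Admissible) {e : X.E} (he : e ≠ ⊥) {S : Finset (Finset X.E)}
    (hS : (S : Set (Finset X.E)) ⊆ X.R e) : prodElt e S ≠ 0 := by
  intro h
  have := hX.chi_self_prodElt he hS
  rw [h, map_zero] at this
  exact zero_ne_one this

theorem le_of_prodElt_eq (hX : X.Admissible) {d e : X.E} (he : e ≠ ⊥)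
    {S T : Finset (Finset X.E)} (hT : (T : Set (Finset X.E)) ⊆ X.R e)
    (h : prodElt d S = prodElt e T) : e ≤ d := by
  have h1 := hX.chi_self_prodElt he hT
  rw [← h, chi_prodElt] at h1
  by_contra hed
  rw [if_neg fun hh => hed hh.1] at h1
  exact zero_ne_one h1

/-- For `G` in `T` but not in `S`, a maximal non-zero `m ∈ G` separates the two elements: by
independence it lies below no element of a cover in `S`, whereas `G` excludes it from `e(T)`. -/
theorem subset_of_prodElt_eq (hX : X.Admissible) {e : X.E} (he : e ≠ ⊥)
    {S T : Finset (Finset X.E)} (hS : (S : Set (Finset X.E)) ⊆ X.R e)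
    (hT : (T : Set (Finset X.E)) ⊆ X.R e) (h : prodElt e S = prodElt e T) : T ⊆ S := by
  classical
  intro G hG
  by_contra hGS
  obtain ⟨m, hm, hm0⟩ := hX.exists_mem_inf_ne_bot he (hT hG) he le_rfl
  have hme : m ≤ e := ((hX.isFiniteCover e he G (hT hG)).1 m hm.1).2
  rw [inf_eq_right.2 hme] at hm0
  have h1 : chi m hm0 (prodElt e S) = 1 := by
    rw [chi_prodElt, if_pos]
    refine ⟨hme, fun F hF f hf hmf => ?_⟩
    have hi : infBelow e {G} (fun _ => m) = m := by simpa [infBelow] using hme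
    refine hX.not_infBelow_le (S := {G}) (ε := fun _ => m) he (by simpa using hT hG) ?_ (hS hF)
      ?_ ?_ hf ?_
    · simpa using mem_supp_join_of_maximal hm hm0
    · rw [Finset.mem_singleton]
      rintro rfl
      exact hGS hF
    · rwa [hi]
    · rwa [hi]
  rw [h, chi_prodElt, if_neg fun hh => hh.2 G hG m hm.1 le_rfl] at h1
  exact zero_ne_one h1

theorem prodElt_injective (hX : X.Admissible) {d e : X.E} (hd : d ≠ ⊥) (he : e ≠ ⊥)
    {S T : Finset (Finset X.E)} (hS : (S : Set (Finset X.E)) ⊆ X.R d)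
    (hT : (T : Set (Finset X.E)) ⊆ X.R e) (h : prodElt d S = prodElt e T) : d = e ∧ S = T := by
  obtain rfl := le_antisymm (hX.le_of_prodElt_eq hd hS h.symm) (hX.le_of_prodElt_eq he hT h)
  exact ⟨rfl, (hX.subset_of_prodElt_eq hd hT hS h.symm).antisymm
    (hX.subset_of_prodElt_eq hd hS hT h)⟩

-- If the first alternative of (i) held for some `F ∈ S`, the top element `d ⊓ e` would itself be
-- removed by `mulCover d F`, and the product would vanish. A non-zero product thus forces the
-- second alternative for every cover.
open Classical in
theorem image_mulCover_subset (hX : X.Admissible) {d e : X.E} (he : e ≠ ⊥)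
    {S : Finset (Finset X.E)} (hS : (S : Set (Finset X.E)) ⊆ X.R e)
    (h : of d * prodElt e S ≠ 0) :
    d ⊓ e ≠ ⊥ ∧ (S.image (mulCover d) : Set (Finset X.E)) ⊆ X.R (d ⊓ e) := by
  have hde : d ⊓ e ≠ ⊥ := by
    intro hde
    refine h (ext_chi fun m hm => ?_)
    rw [of_mul_prodElt, hde, chi_prodElt, if_neg, map_zero]
    exact fun hh => hm (le_bot_iff.1 hh.1)
  refine ⟨hde, ?_⟩
  intro F' hF'
  rw [Finset.mem_coe, Finset.mem_image] at hF'
  obtain ⟨F, hF, rfl⟩ := hF'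
  have hd : d ≠ ⊥ := fun hd => hde (by rw [hd, bot_inf_eq])
  refine (hX.cond_i d e hd he hde F (hS hF)).resolve_left fun hmem => h ?_
  rw [of_mul_prodElt]
  refine ext_chi fun m hm => ?_
  rw [chi_prodElt, map_zero, if_neg]
  exact fun hh => hh.2 _ (Finset.mem_image_of_mem _ hF) _ hmem hh.1

theorem of_mul_mem_nextSet (hX : X.Admissible) (d : X.E) {x : SemigroupRing X.E}
    (hx : x ∈ X.nextSet) : of d * x ∈ X.nextSet := by
  classical
  by_cases h : of d * x = 0
  · exact Or.inr h
  rcases hx with ⟨e, he, S, hS, hSR, rfl⟩ | hx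
  · obtain ⟨h1, h2⟩ := hX.image_mulCover_subset he hSR h
    exact Or.inl ⟨d ⊓ e, h1, S.image (mulCover d), hS.image _, h2, of_mul_prodElt d e S⟩
  · exact (h (by rw [Set.mem_singleton_iff.1 hx, mul_zero])).elim

open Classical in
theorem union_image_subset (hX : X.Admissible) {d e : X.E} (hd : d ≠ ⊥) (he : e ≠ ⊥)
    {S T : Finset (Finset X.E)} (hS : (S : Set (Finset X.E)) ⊆ X.R d)
    (hT : (T : Set (Finset X.E)) ⊆ X.R e) (h : prodElt d S * prodElt e T ≠ 0) :
    d ⊓ e ≠ ⊥ ∧ ((S.image (mulCover e) ∪ T.image (mulCover d) : Finset (Finset X.E)) :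
      Set (Finset X.E)) ⊆ X.R (d ⊓ e) := by
  have h1 : prodElt d S * prodElt e T = of e * prodElt d S * prodElt e T := by
    refine ext_chi fun m hm => ?_
    simp only [map_mul, chi_prodElt, chi_of, ite_zero_mul_ite_zero, one_mul]
    refine if_congr ?_ rfl rfl
    tauto
  have h2 : prodElt d S * prodElt e T = prodElt d S * (of d * prodElt e T) := by
    refine ext_chi fun m hm => ?_
    simp only [map_mul, chi_prodElt, chi_of, ite_zero_mul_ite_zero, one_mul]
    refine if_congr ?_ rfl rfl
    tauto
  have h3 := hX.image_mulCover_subset hd hS fun h0 => h (by rw [h1, h0, zero_mul])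
  have h4 := hX.image_mulCover_subset he hT fun h0 => h (by rw [h2, h0, mul_zero])
  rw [inf_comm] at h3
  refine ⟨h4.1, ?_⟩
  rw [Finset.coe_union]
  exact Set.union_subset h3.2 h4.2

theorem mul_mem_nextSet (hX : X.Admissible) {x y : SemigroupRing X.E} (hx : x ∈ X.nextSet)
    (hy : y ∈ X.nextSet) : x * y ∈ X.nextSet := by
  classical
  by_cases h : x * y = 0
  · exact Or.inr h
  rcases hx with ⟨d, hd, S, hS, hSR, rfl⟩ | hx
  · rcases hy with ⟨e, he, T, hT, hTR, rfl⟩ | hy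
    · obtain ⟨h1, h2⟩ := hX.union_image_subset hd he hSR hTR h
      exact Or.inl ⟨d ⊓ e, h1, _, (hS.image _).mono Finset.subset_union_left, h2,
        prodElt_mul_prodElt d e S T⟩
    · exact (h (by rw [Set.mem_singleton_iff.1 hy, mul_zero])).elim
  · exact (h (by rw [Set.mem_singleton_iff.1 hx, zero_mul])).elim

theorem carrier_eq (hX : X.Admissible) :
    (X.nextSemigroup : Set (SemigroupRing X.E)) = X.nextSet := by
  refine Set.Subset.antisymm ?_ ?_
  · rintro x ⟨hx, -⟩
    exact Subsemigroup.closure_induction (fun _ h => h)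
      (fun _ _ _ _ hx hy => hX.mul_mem_nextSet hx hy) hx
  · intro x hx
    refine ⟨Subsemigroup.subset_closure hx, ?_⟩
    rcases hx with ⟨d, hd, S, hS, hSR, rfl⟩ | hx
    · exact isIdempotentElem_prodElt d S
    · rw [Set.mem_singleton_iff.1 hx]
      exact zero_mul 0

theorem mem_nextSemigroup (hX : X.Admissible) {x : SemigroupRing X.E} :
    x ∈ X.nextSemigroup ↔ x ∈ X.nextSet := by
  rw [← hX.carrier_eq, SetLike.mem_coe]

theorem exists_next_eq (hX : X.Admissible) {x : SemigroupRing X.E} (hx : x ∈ X.nextSet) :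
    ∃ t : X.Next, X.incl t = x :=
  ⟨⟨x, hX.mem_nextSemigroup.2 hx⟩, rfl⟩

theorem incl_mem_nextSet (hX : X.Admissible) (x : X.Next) : X.incl x ∈ X.nextSet :=
  hX.mem_nextSemigroup.1 x.2

theorem exists_incl_eq_prodElt (hX : X.Admissible) {x : X.Next} (hx : x ≠ ⊥) :
    ∃ e, e ≠ ⊥ ∧ ∃ S : Finset (Finset X.E), S.Nonempty ∧ (S : Set (Finset X.E)) ⊆ X.R e ∧
      X.incl x = prodElt e S :=
  (hX.incl_mem_nextSet x).resolve_right fun h => hx (X.incl_injective h)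

theorem prodElt_insert_mem_nextSet {e : X.E} (he : e ≠ ⊥) {S : Finset (Finset X.E)}
    (hS : (S : Set (Finset X.E)) ⊆ X.R e) {G : Finset X.E} (hG : G ∈ X.R e)
    [DecidableEq (Finset X.E)] : prodElt e (insert G S) ∈ X.nextSet :=
  Or.inl ⟨e, he, insert G S, Finset.insert_nonempty _ _,
    by rw [Finset.coe_insert]; exact Set.insert_subset hG hS, rfl⟩

theorem nextCover_subset (hX : X.Admissible) {e : X.E} (he : e ≠ ⊥) {S : Finset (Finset X.E)}
    (hS : S.Nonempty) (hSR : (S : Set (Finset X.E)) ⊆ X.R e) {G : Finset X.E} (hG : G ∈ X.R e) :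
    X.nextCover e S G ⊆ X.nextSet := by
  classical
  rintro x (hx | ⟨-, f, -, rfl⟩)
  · rw [Set.mem_singleton_iff.1 hx]
    exact prodElt_insert_mem_nextSet he hSR hG
  · exact hX.of_mul_mem_nextSet f (Or.inl ⟨e, he, S, hS, hSR, rfl⟩)

theorem wellDefined (hX : X.Admissible) : X.WellDefined where
  carrier_eq := hX.carrier_eq
  prodElt_ne_zero _ he _ _ hS := hX.prodElt_ne_zero he hS
  prodElt_injective _ _ hd he _ _ _ _ hS hT h := hX.prodElt_injective hd he hS hT h
  nextCover_subset e he S hS hSR G hG _ := by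
    rw [hX.carrier_eq]
    exact hX.nextCover_subset he hS hSR hG

end Admissible

/-! ### The order of `E(E, ℛ)` in terms of characters -/

theorem chi_incl (x : X.Next) {m : X.E} (hm : m ≠ ⊥) :
    chi m hm (X.incl x) = 0 ∨ chi m hm (X.incl x) = 1 := by
  have h : X.incl x * X.incl x = X.incl x := x.2.2
  rw [← IsIdempotentElem.iff_eq_zero_or_one, IsIdempotentElem, ← map_mul, h]

/-- Characters take only the values 0 and 1 on idempotents, so members of `E(E, ℛ)` are sets of
points and the order is inclusion. -/
theorem next_le_iff_chi {x y : X.Next} :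
    x ≤ y ↔ ∀ m hm, chi m hm (X.incl x) = 1 → chi m hm (X.incl y) = 1 := by
  rw [next_le_iff]
  constructor
  · intro h m hm hx
    rw [← h, map_mul] at hx
    rcases chi_incl y hm with h0 | h1
    · rw [h0, mul_zero] at hx
      exact (zero_ne_one hx).elim
    · exact h1
  · intro h
    refine ext_chi fun m hm => ?_
    rw [map_mul]
    rcases chi_incl x hm with h0 | h1
    · rw [h0, zero_mul]
    · rw [h m hm h1, h1, mul_one]

theorem next_ne_bot_iff_chi {x : X.Next} : x ≠ ⊥ ↔ ∃ m hm, chi m hm (X.incl x) = 1 := by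
  rw [Ne, ← le_bot_iff, next_le_iff_chi]
  push Not
  refine exists_congr fun m => exists_congr fun hm => ?_
  rw [incl_bot, map_zero]
  simp

theorem chi_incl_inf {x y : X.Next} {m : X.E} (hm : m ≠ ⊥) :
    chi m hm (X.incl (x ⊓ y)) = 1 ↔ chi m hm (X.incl x) = 1 ∧ chi m hm (X.incl y) = 1 := by
  rw [incl_inf, map_mul]
  rcases chi_incl x hm with h | h <;> rcases chi_incl y hm with h' | h' <;> simp [h, h']

theorem mem_iff_incl_mem {T : Finset X.Next} {A : Set (SemigroupRing X.E)}
    (h : X.incl '' (T : Set X.Next) = A) {t : X.Next} : t ∈ T ↔ X.incl t ∈ A := by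
  rw [← h, X.incl_injective.mem_set_image, Finset.mem_coe]

end CoverSystem

namespace CoverSystem

variable {Γ : Type v} [Group Γ] {X : CoverSystem.{u, v} Γ}

/-! ### Admissibility of the derived system -/

namespace Admissible

open Classical in
theorem chi_prodElt_of_mem_nextCover {e : X.E} {S : Finset (Finset X.E)} {G : Finset X.E}
    {m : X.E} (hm : m ≠ ⊥) {x : SemigroupRing X.E} (hx : x ∈ X.nextCover e S G)
    (h : chi m hm x = 1) :
    chi m hm (prodElt e S) = 1 := by
  rw [chi_prodElt]
  rcases hx with hx | ⟨-, f, -, rfl⟩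
  · rw [Set.mem_singleton_iff.1 hx, chi_prodElt] at h
    rw [if_pos]
    by_contra hh
    rw [if_neg] at h
    · exact zero_ne_one h
    · rintro ⟨h1, h2⟩
      exact hh ⟨h1, fun F hF => h2 F (Finset.mem_insert_of_mem hF)⟩
  · by_contra hh
    rw [map_mul, chi_prodElt, if_neg (fun h' => hh (by rw [if_pos h'])), mul_zero] at h
    exact zero_ne_one h

/-- A point `m` of a non-zero `y ≤ e(𝒮)` either lies below some `f ∈ G`, and then `y` meets `f ·
e(𝒮)`, or below none, and then `y` meets `e(𝒮 ∪ {G})`. -/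
theorem isFiniteCover_next (hX : X.Admissible) {x : X.Next} {T : Finset X.Next}
    (hT : T ∈ X.nextR x) : IsFiniteCover x T := by
  classical
  obtain ⟨e, he, S, hS, hSR, G, hG, hGS, hxS, hT⟩ := hT
  have hmem {t : X.Next} : t ∈ T ↔ X.incl t ∈ X.nextCover e S G := mem_iff_incl_mem hT
  refine ⟨fun t ht => ⟨?_, ?_⟩, fun y hy hyx => ?_⟩
  · rintro rfl
    rcases hmem.1 ht with h | h
    · refine hX.prodElt_ne_zero he (S := insert G S) ?_ (Set.mem_singleton_iff.1 h).symm
      rw [Finset.coe_insert]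
      exact Set.insert_subset hG hSR
    · exact h.1 rfl
  · rw [next_le_iff_chi, hxS]
    exact fun m hm => chi_prodElt_of_mem_nextCover hm (hmem.1 ht)
  · obtain ⟨m, hm, hmy⟩ := next_ne_bot_iff_chi.1 hy
    have hmx := next_le_iff_chi.1 hyx m hm hmy
    by_cases hf : ∃ f ∈ G, m ≤ f
    · obtain ⟨f, hf, hmf⟩ := hf
      obtain ⟨t, ht⟩ := hX.exists_next_eq (hX.of_mul_mem_nextSet f (hX.incl_mem_nextSet x))
      have hmt : chi m hm (X.incl t) = 1 := by
        rw [ht, map_mul, hmx, chi_of, if_pos hmf, mul_one]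
      refine ⟨t, hmem.2 (Or.inr ⟨?_, f, hf, by rw [ht, hxS]⟩), ?_⟩
      · intro h0
        rw [h0, map_zero] at hmt
        exact zero_ne_one hmt
      · exact next_ne_bot_iff_chi.2 ⟨m, hm, (chi_incl_inf hm).2 ⟨hmy, hmt⟩⟩
    · obtain ⟨t, ht⟩ := hX.exists_next_eq (prodElt_insert_mem_nextSet he hSR hG)
      refine ⟨t, hmem.2 (Or.inl ht), ?_⟩
      refine next_ne_bot_iff_chi.2 ⟨m, hm, (chi_incl_inf hm).2 ⟨hmy, ?_⟩⟩
      rw [hxS, chi_prodElt] at hmx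
      rw [ht, chi_prodElt, if_pos]
      by_contra hh
      rw [if_neg] at hmx
      · exact zero_ne_one hmx
      · rintro ⟨h1, h2⟩
        refine hh ⟨h1, ?_⟩
        rw [Finset.forall_mem_insert]
        exact ⟨fun f hfG hmf => hf ⟨f, hfG, hmf⟩, h2⟩

/-- With `x = d(U)`, `y = e(S)` and `xy = (de)(V)`, multiplication by `x` carries the cover attached
to `(S, G)` to the one attached to `(V, dG)`. This fails to be a derived cover only if `de ∈ dG` or
`dG ∈ V`; then `xy` already occurs, as `x · f · y` for an `f ∈ G` with `df = de`, respectively as `x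
· e(S ∪ {G})`. -/
theorem cond_i_next (hX : X.Admissible) {x y : X.Next} (hxy : x ⊓ y ≠ ⊥) {T : Finset X.Next}
    (hT : T ∈ X.nextR y) : x ⊓ y ∈ mulCover x T ∨ mulCover x T ∈ X.nextR (x ⊓ y) := by
  classical
  have hx : x ≠ ⊥ := by
    rintro rfl
    exact hxy (bot_inf_eq _)
  obtain ⟨d, hd, U, hU, hUR, hxU⟩ := hX.exists_incl_eq_prodElt hx
  obtain ⟨e, he, S, hS, hSR, G, hG, hGS, hyS, hT⟩ := hT
  have hmem {t : X.Next} : t ∈ T ↔ X.incl t ∈ X.nextCover e S G := mem_iff_incl_mem hT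
  have hmulmem {t : X.Next} (ht : X.incl t ∈ X.nextCover e S G) (h : x ⊓ t ≠ ⊥) :
      x ⊓ t ∈ mulCover x T := mem_mulCover.2 ⟨h, t, hmem.2 ht, rfl⟩
  obtain ⟨hde, hVR⟩ := hX.union_image_subset hd he hUR hSR
    (by rw [← hxU, ← hyS, ← incl_inf]; exact fun h => hxy (X.incl_injective h))
  set V := U.image (mulCover e) ∪ S.image (mulCover d) with hVdef
  have hxyV : X.incl (x ⊓ y) = prodElt (d ⊓ e) V := by
    rw [incl_inf, hxU, hyS, prodElt_mul_prodElt]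
  have hins : X.incl x * prodElt e (insert G S) = prodElt (d ⊓ e) (insert (mulCover d G) V) := by
    rw [hxU, prodElt_mul_prodElt, Finset.image_insert, Finset.union_insert]
  have hsmul (f : X.E) :
      X.incl x * (of f * prodElt e S) = of (d ⊓ f) * prodElt (d ⊓ e) V := by
    rw [← hyS, mul_left_comm, ← incl_inf, hxyV]
    refine ext_chi fun m hm => ?_
    simp only [map_mul, chi_prodElt, chi_of, ite_zero_mul_ite_zero, one_mul, le_inf_iff]
    refine if_congr ?_ rfl rfl
    tauto
  obtain ⟨a, ha⟩ := hX.exists_next_eq (prodElt_insert_mem_nextSet he hSR hG)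
  have haT : X.incl a ∈ X.nextCover e S G := Or.inl ha
  have hb (f : X.E) : ∃ b : X.Next, X.incl b = of f * prodElt e S := by
    rw [← hyS]
    exact hX.exists_next_eq (hX.of_mul_mem_nextSet f (hX.incl_mem_nextSet y))
  rcases hX.cond_i d e hd he hde G hG with h | h
  · obtain ⟨-, f, hf, hfe⟩ := mem_mulCover.1 h
    obtain ⟨b, hb⟩ := hb f
    have hxb : x ⊓ b = x ⊓ y := by
      apply X.incl_injective
      rw [hxyV, incl_inf, hb, hsmul, hfe]
      refine ext_chi fun m hm => ?_
      simp only [map_mul, chi_prodElt, chi_of, ite_zero_mul_ite_zero, one_mul]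
      refine if_congr ?_ rfl rfl
      tauto
    left
    rw [← hxb] at hxy ⊢
    refine hmulmem (Or.inr ⟨?_, f, hf, hb⟩) hxy
    intro h0
    exact hxy (X.incl_injective (by rw [incl_inf, h0, mul_zero, incl_bot]))
  · by_cases hGV : mulCover d G ∈ V
    · have hxa : x ⊓ a = x ⊓ y := by
        apply X.incl_injective
        rw [hxyV, incl_inf, ha, hins, Finset.insert_eq_of_mem hGV]
      left
      rw [← hxa] at hxy ⊢
      exact hmulmem haT hxy
    · right
      refine ⟨d ⊓ e, hde, V, (hS.image _).mono Finset.subset_union_right, hVR, mulCover d G, h,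
        hGV, hxyV, Set.Subset.antisymm ?_ ?_⟩
      · rintro _ ⟨t', ht', rfl⟩
        obtain ⟨h0, t, ht, rfl⟩ := mem_mulCover.1 (Finset.mem_coe.1 ht')
        rcases hmem.1 ht with hta | ⟨-, f, hf, htf⟩
        · left
          rw [incl_inf, Set.mem_singleton_iff.1 hta, hins]
          rfl
        · have hz : X.incl (x ⊓ t) ≠ 0 := fun hz => h0 (X.incl_injective hz)
          refine Or.inr ⟨hz, d ⊓ f, mem_mulCover.2 ⟨?_, f, hf, rfl⟩, ?_⟩
          · intro hdf
            rw [incl_inf, htf, hsmul, hdf, of_bot, zero_mul] at hz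
            exact hz rfl
          · rw [incl_inf, htf, hsmul]
      · rintro z (hz | ⟨hz0, f', hf', rfl⟩)
        · have hxa : X.incl (x ⊓ a) = z := by
            rw [incl_inf, ha, hins, Set.mem_singleton_iff.1 hz]
          refine ⟨x ⊓ a, hmulmem haT ?_, hxa⟩
          rintro h0
          rw [h0, Set.mem_singleton_iff.1 hz] at hxa
          refine hX.prodElt_ne_zero hde (S := insert (mulCover d G) V) ?_ hxa.symm
          rw [Finset.coe_insert]
          exact Set.insert_subset h hVR
        · obtain ⟨-, f, hf, rfl⟩ := mem_mulCover.1 hf'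
          obtain ⟨b, hb⟩ := hb f
          have hxb : X.incl (x ⊓ b) = of (d ⊓ f) * prodElt (d ⊓ e) V := by
            rw [incl_inf, hb, hsmul]
          refine ⟨x ⊓ b, hmulmem (Or.inr ⟨?_, f, hf, hb⟩) ?_, hxb⟩
          · intro h0
            rw [incl_inf, h0, mul_zero] at hxb
            exact hz0 hxb.symm
          · intro h0
            rw [h0, incl_bot] at hxb
            exact hz0 hxb.symm

end Admissible
end CoverSystem

namespace CoverSystem

variable {Γ : Type v} [Group Γ] {X : CoverSystem.{u, v} Γ}

/-! ### Joins of derived covers, and condition (ii) for the derived system -/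

namespace Admissible

theorem mem_nextR_iff (hX : X.Admissible) {x : X.Next} {e : X.E} (he : e ≠ ⊥)
    {S : Finset (Finset X.E)} (hS : S.Nonempty) (hSR : (S : Set (Finset X.E)) ⊆ X.R e)
    (hx : X.incl x = prodElt e S) {T : Finset X.Next} :
    T ∈ X.nextR x ↔ ∃ G ∈ X.R e, G ∉ S ∧ X.incl '' (T : Set X.Next) = X.nextCover e S G := by
  constructor
  · rintro ⟨e', he', S', hS', hSR', G, hG, hGS, hx', hT⟩
    obtain ⟨rfl, rfl⟩ := hX.prodElt_injective he he' hSR hSR' (hx.symm.trans hx')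
    exact ⟨G, hG, hGS, hT⟩
  · rintro ⟨G, hG, hGS, hT⟩
    exact ⟨e, he, S, hS, hSR, G, hG, hGS, hx, hT⟩

/-- The element `d · x` of `E(E, ℛ)`. -/
def smulNext (hX : X.Admissible) (x : X.Next) (d : X.E) : X.Next :=
  ⟨of d * X.incl x,
    hX.mem_nextSemigroup.2 (hX.of_mul_mem_nextSet d (hX.incl_mem_nextSet x))⟩

theorem incl_smulNext (hX : X.Admissible) (x : X.Next) (d : X.E) :
    X.incl (hX.smulNext x d) = of d * X.incl x := rfl

theorem smulNext_bot (hX : X.Admissible) (x : X.Next) : hX.smulNext x ⊥ = ⊥ :=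
  X.incl_injective (by rw [incl_smulNext, of_bot, zero_mul, incl_bot])

theorem smulNext_inf (hX : X.Admissible) (x : X.Next) (c d : X.E) :
    hX.smulNext x (c ⊓ d) = hX.smulNext x c ⊓ hX.smulNext x d := by
  have h : X.incl x * X.incl x = X.incl x := x.2.2
  apply X.incl_injective
  rw [incl_inf, incl_smulNext, incl_smulNext, incl_smulNext, mul_mul_mul_comm, h, of_mul_of]

/-- The homomorphism `ℤ[E^×] → ℤ[E(E, ℛ)^×]` with `d ↦ d · x`. -/
def smulHom (hX : X.Admissible) (x : X.Next) : SemigroupRing X.E →ₙ+* SemigroupRing X.Next :=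
  lift (fun d => of (hX.smulNext x d)) (by rw [smulNext_bot, of_bot])
    (fun c d => by rw [smulNext_inf, of_mul_of])

theorem smulHom_of (hX : X.Admissible) (x : X.Next) (d : X.E) :
    hX.smulHom x (of d) = of (hX.smulNext x d) := lift_of _ _ _ d

theorem mem_cover_iff (hX : X.Admissible) {x a : X.Next} {e : X.E} {S : Finset (Finset X.E)}
    (hx : X.incl x = prodElt e S) {G : Finset X.E} [DecidableEq (Finset X.E)]
    (ha : X.incl a = prodElt e (insert G S)) {T : Finset X.Next}
    (hT : X.incl '' (T : Set X.Next) = X.nextCover e S G) {t : X.Next} (ht : t ≠ ⊥) :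
    t ∈ T ↔ t = a ∨ ∃ f ∈ G, t = hX.smulNext x f := by
  rw [mem_iff_incl_mem hT]
  refine or_congr ?_ ⟨?_, ?_⟩
  · rw [Set.mem_singleton_iff, ← X.incl_injective.eq_iff, ha]
    constructor <;> intro h <;> convert h
  · rintro ⟨-, f, hf, h⟩
    exact ⟨f, hf, X.incl_injective (by rw [h, incl_smulNext, hx])⟩
  · rintro ⟨f, hf, rfl⟩
    exact ⟨fun h => ht (X.incl_injective h), f, hf, by rw [incl_smulNext, hx]⟩

/-- No non-zero element of `E(E, ℛ)` lies below both `e(S ∪ {G})` and some `f · e(S)`, so the join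
splits as a sum. Both sides are compared under the characters of `ℤ[E(E, ℛ)^×]`, one level above
those used so far. -/
theorem join_cover (hX : X.Admissible) {x a : X.Next} {e : X.E} (he : e ≠ ⊥)
    {S : Finset (Finset X.E)} (hSR : (S : Set (Finset X.E)) ⊆ X.R e)
    (hx : X.incl x = prodElt e S) {G : Finset X.E} (hG : G ∈ X.R e) [DecidableEq (Finset X.E)]
    (ha : X.incl a = prodElt e (insert G S)) {T : Finset X.Next}
    (hT : X.incl '' (T : Set X.Next) = X.nextCover e S G) :
    join T = of a + hX.smulHom x (join G) := by
  classical
  have ha0 : a ≠ ⊥ := by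
    rintro rfl
    refine hX.prodElt_ne_zero he (S := insert G S) ?_ ha.symm
    rw [Finset.coe_insert]
    exact Set.insert_subset hG hSR
  refine ext_chi fun y hy => ?_
  have hψ (f : X.E) : ((chi y hy).comp (hX.smulHom x)) (of f) =
      if y ≤ hX.smulNext x f then 1 else 0 := by
    rw [NonUnitalRingHom.comp_apply, smulHom_of, chi_of]
  have h1 : chi y hy (hX.smulHom x (join G)) =
      if ∃ f ∈ G, y ≤ hX.smulNext x f then 1 else 0 := by
    rw [← NonUnitalRingHom.comp_apply, map_join_of_zero_or_one]
    · simp [hψ]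
    · intro f _
      rw [hψ]
      split_ifs <;> simp
  have h2 : (∃ t ∈ T, y ≤ t) ↔ y ≤ a ∨ ∃ f ∈ G, y ≤ hX.smulNext x f := by
    constructor
    · rintro ⟨t, ht, hyt⟩
      have ht0 : t ≠ ⊥ := fun h => hy (le_bot_iff.1 (h ▸ hyt))
      rcases (hX.mem_cover_iff hx ha hT ht0).1 ht with rfl | ⟨f, hf, rfl⟩
      · exact Or.inl hyt
      · exact Or.inr ⟨f, hf, hyt⟩
    · rintro (h | ⟨f, hf, h⟩)
      · exact ⟨a, (hX.mem_cover_iff hx ha hT ha0).2 (Or.inl rfl), h⟩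
      · exact ⟨_, (hX.mem_cover_iff hx ha hT fun h0 => hy (le_bot_iff.1 (h0 ▸ h))).2
          (Or.inr ⟨f, hf, rfl⟩), h⟩
  have h3 : y ≤ a → ¬ ∃ f ∈ G, y ≤ hX.smulNext x f := by
    rintro hya ⟨f, hf, hyf⟩
    obtain ⟨m, hm, hmy⟩ := next_ne_bot_iff_chi.1 hy
    have h4 := next_le_iff_chi.1 hya m hm hmy
    have h5 := next_le_iff_chi.1 hyf m hm hmy
    rw [ha, chi_prodElt] at h4
    rw [incl_smulNext, map_mul, chi_of] at h5
    by_cases hmf : m ≤ f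
    · rw [if_neg fun hh => hh.2 G (Finset.mem_insert_self _ _) f hf hmf] at h4
      exact zero_ne_one h4
    · rw [if_neg hmf, zero_mul] at h5
      exact zero_ne_one h5
  rw [map_add, chi_join, chi_of, h1]
  by_cases h6 : y ≤ a
  · rw [if_pos (h2.2 (Or.inl h6)), if_pos h6, if_neg (h3 h6), add_zero]
  · rw [if_neg h6, zero_add]
    exact if_congr (h2.trans (or_iff_right h6)) rfl rfl

/-- Read off from `join_cover`. The second form keeps `η` in the support of `join G`, which is
exactly what (ii) for the original system accepts. -/
theorem mem_supp_join_cover (hX : X.Admissible) {x : X.Next} {e : X.E} (he : e ≠ ⊥)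
    {S : Finset (Finset X.E)} (hSR : (S : Set (Finset X.E)) ⊆ X.R e)
    (hx : X.incl x = prodElt e S) {G : Finset X.E} (hG : G ∈ X.R e) [DecidableEq (Finset X.E)]
    {T : Finset X.Next} (hT : X.incl '' (T : Set X.Next) = X.nextCover e S G) {t : X.Next}
    (ht : t ∈ supp (join T)) :
    X.incl t = prodElt e (insert G S) ∨
      ∃ η ∈ supp (join G), X.incl t = of η * prodElt e S := by
  obtain ⟨a, ha⟩ := hX.exists_next_eq (prodElt_insert_mem_nextSet he hSR hG)
  have h : supp (join T) ⊆ {a} ∪ hX.smulNext x '' supp (join G) := by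
    rw [supp_subset_iff_mem_closure, hX.join_cover he hSR hx hG ha hT]
    refine add_mem (AddSubgroup.subset_closure (Set.mem_image_of_mem of (Or.inl rfl))) ?_
    have h1 : join G ∈ AddSubgroup.closure (of '' supp (join G)) :=
      supp_subset_iff_mem_closure.1 subset_rfl
    have h2 : AddSubgroup.closure (of '' supp (join G)) ≤ (AddSubgroup.closure
        (of '' ({a} ∪ hX.smulNext x '' supp (join G)))).comap
          (hX.smulHom x : SemigroupRing X.E →+ SemigroupRing X.Next) := by
      rw [AddSubgroup.closure_le]
      rintro _ ⟨η, hη, rfl⟩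
      refine AddSubgroup.subset_closure ?_
      exact ⟨_, Or.inr (Set.mem_image_of_mem _ hη), (hX.smulHom_of x η).symm⟩
    exact h2 h1
  rcases h ht with h | ⟨η, hη, rfl⟩
  · left
    rw [Set.mem_singleton_iff.1 h, ha]
  · exact Or.inr ⟨η, hη, by rw [incl_smulNext, hx]⟩

/-- A reindexed `not_infBelow_le`: products over derived covers are indexed by those covers, not by
the original covers they come from. -/
theorem not_infBelow_le_of_injOn (hX : X.Admissible) {ι : Type w} {e : X.E} (he : e ≠ ⊥)
    {s : Finset ι} {g : ι → Finset X.E} (hinj : Set.InjOn g s) (hg : ∀ i ∈ s, g i ∈ X.R e)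
    {ε : ι → X.E} (hε : ∀ i ∈ s, ε i ∈ supp (join (g i))) {G : Finset X.E} (hG : G ∈ X.R e)
    (hGs : ∀ i ∈ s, g i ≠ G) (h0 : infBelow e s ε ≠ ⊥) {f : X.E} (hf : f ∈ G) :
    ¬ infBelow e s ε ≤ f := by
  classical
  rcases s.eq_empty_or_nonempty with rfl | ⟨i, _⟩
  · simpa [infBelow] using hX.not_le_of_mem he hG hf
  have : Nonempty ι := ⟨i⟩
  have hinv {i : ι} (hi : i ∈ s) : Function.invFunOn g s (g i) = i :=
    hinj.leftInvOn_invFunOn hi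
  have heq : infBelow e (s.image g) (ε ∘ Function.invFunOn g s) = infBelow e s ε := by
    unfold infBelow
    rw [Finset.fold_image hinj]
    exact Finset.fold_congr fun i hi => congrArg ε (hinv hi)
  rw [← heq] at h0 ⊢
  refine hX.not_infBelow_le he ?_ ?_ hG ?_ h0 hf
  · intro F hF
    rw [Finset.mem_coe, Finset.mem_image] at hF
    obtain ⟨i, hi, rfl⟩ := hF
    exact hg i hi
  · rw [Finset.forall_mem_image]
    intro i hi
    rw [Function.comp_apply, hinv hi]
    exact hε i hi
  · rw [Finset.mem_image]
    rintro ⟨i, hi, h⟩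
    exact hGs i hi h

theorem chi_infBelow {ι : Type w} {x : X.Next} {s : Finset ι} {ε : ι → X.Next} {m : X.E}
    (hm : m ≠ ⊥) : chi m hm (X.incl (infBelow x s ε)) = 1 ↔
      chi m hm (X.incl x) = 1 ∧ ∀ i ∈ s, chi m hm (X.incl (ε i)) = 1 := by
  classical
  unfold infBelow
  induction s using Finset.induction_on with
  | empty => simp
  | insert a s ha ih =>
    rw [Finset.fold_insert ha, chi_incl_inf, ih, Finset.forall_mem_insert]
    tauto

theorem chi_prodElt_eq_one {m : X.E} (hm : m ≠ ⊥) {e : X.E} {S : Finset (Finset X.E)} :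
    chi m hm (prodElt e S) = 1 ↔ m ≤ e ∧ ∀ F ∈ S, ∀ f ∈ F, ¬ m ≤ f := by
  classical
  rw [chi_prodElt]
  split_ifs with h
  · exact iff_of_true rfl h
  · exact iff_of_false zero_ne_one h

theorem chi_of_mul_prodElt_eq_one {m : X.E} (hm : m ≠ ⊥) {d e : X.E} {S : Finset (Finset X.E)} :
    chi m hm (of d * prodElt e S) = 1 ↔ m ≤ d ∧ m ≤ e ∧ ∀ F ∈ S, ∀ f ∈ F, ¬ m ≤ f := by
  rw [← chi_prodElt_eq_one hm, map_mul, chi_of]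
  split_ifs with h <;> simp [h]

-- If the inequality were not strict, the product over the remaining covers would lie below `ε T₀`.
-- Depending on the form of `ε T₀`, a suitable point of that product then contradicts the
-- independence of the original covers.
open Classical in
theorem cond_ii_next (hX : X.Admissible) {x : X.Next} (hx : x ≠ ⊥)
    {C : Finset (Finset X.Next)} (hC : (C : Set (Finset X.Next)) ⊆ X.nextR x)
    {ε : Finset X.Next → X.Next} (hε : ∀ T ∈ C, ε T ∈ supp (join T)) {T₀ : Finset X.Next}
    (hT₀ : T₀ ∈ C) (h0 : infBelow x (C.erase T₀) ε ≠ ⊥) :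
    infBelow x C ε < infBelow x (C.erase T₀) ε := by
  obtain ⟨e, he, S, hS, hSR, hxS⟩ := hX.exists_incl_eq_prodElt hx
  have hex : ∀ T ∈ C, ∃ G ∈ X.R e, G ∉ S ∧ X.incl '' (T : Set X.Next) = X.nextCover e S G :=
    fun T hT => (hX.mem_nextR_iff he hS hSR hxS).1 (hC hT)
  choose! g hgR hgS hg using hex
  have hginj : Set.InjOn g C := by
    intro T hT T' hT' h
    have := (hg T hT).trans ((congrArg (X.nextCover e S) h).trans (hg T' hT').symm)
    exact Finset.coe_injective (X.incl_injective.image_injective this)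
  have hor : ∀ T ∈ C, ¬ X.incl (ε T) = prodElt e (insert (g T) S) →
      ∃ η ∈ supp (join (g T)), X.incl (ε T) = of η * prodElt e S := fun T hT h =>
    (hX.mem_supp_join_cover he hSR hxS (hgR T hT) (hg T hT) (hε T hT)).resolve_left h
  choose! η hη hηε using hor
  refine lt_of_le_not_ge ?_ fun hle => ?_
  · rw [le_infBelow_iff]
    exact ⟨(le_infBelow_iff.1 le_rfl).1, fun T hT =>
      (le_infBelow_iff.1 le_rfl).2 T (Finset.mem_of_mem_erase hT)⟩
  replace hle := (le_infBelow_iff.1 hle).2 T₀ hT₀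
  -- `B` collects the covers whose chosen element has the form `η · e(S)`; the others contribute
  -- only conditions of the form "not below `f`".
  set B := (C.erase T₀).filter fun T => ¬ X.incl (ε T) = prodElt e (insert (g T) S) with hB
  have hBC {T : Finset X.Next} (hT : T ∈ B) : T ≠ T₀ ∧ T ∈ C ∧
      ¬ X.incl (ε T) = prodElt e (insert (g T) S) := by
    simpa [hB, and_assoc] using hT
  -- the set of points of the product over `C.erase T₀`
  have hchi (m : X.E) (hm : m ≠ ⊥) : chi m hm (X.incl (infBelow x (C.erase T₀) ε)) = 1 ↔
      m ≤ infBelow e B η ∧ (∀ F ∈ S, ∀ f ∈ F, ¬ m ≤ f) ∧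
        ∀ T ∈ C.erase T₀, X.incl (ε T) = prodElt e (insert (g T) S) → ∀ f ∈ g T, ¬ m ≤ f := by
    rw [chi_infBelow, hxS, chi_prodElt_eq_one, le_infBelow_iff]
    constructor
    · rintro ⟨⟨h1, h2⟩, h3⟩
      refine ⟨⟨h1, fun T hT => ?_⟩, h2, fun T hT hTP => ?_⟩
      · have h4 := h3 T (Finset.mem_of_mem_filter T hT)
        rw [hηε T (hBC hT).2.1 (hBC hT).2.2, chi_of_mul_prodElt_eq_one] at h4
        exact h4.1
      · have h4 := h3 T hT
        rw [hTP, chi_prodElt_eq_one] at h4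
        exact h4.2 (g T) (Finset.mem_insert_self _ _)
    · rintro ⟨⟨h1, h2⟩, h3, h4⟩
      refine ⟨⟨h1, h3⟩, fun T hT => ?_⟩
      by_cases hTP : X.incl (ε T) = prodElt e (insert (g T) S)
      · rw [hTP, chi_prodElt_eq_one, Finset.forall_mem_insert]
        exact ⟨h1, h4 T hT hTP, h3⟩
      · rw [hηε T (Finset.mem_of_mem_erase hT) hTP, chi_of_mul_prodElt_eq_one]
        exact ⟨h2 T (Finset.mem_filter.2 ⟨hT, hTP⟩), h1, h3⟩
  obtain ⟨m₀, hm₀, hm₀y⟩ := next_ne_bot_iff_chi.1 h0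
  obtain ⟨hm₀B, hm₀S, hm₀A⟩ := (hchi m₀ hm₀).1 hm₀y
  have hB0 : infBelow e B η ≠ ⊥ := fun h => hm₀ (le_bot_iff.1 (h ▸ hm₀B))
  by_cases hT₀P : X.incl (ε T₀) = prodElt e (insert (g T₀) S)
  -- Here `ε T₀` excludes everything below an element of `g T₀`. Cutting the product over `B` down
  -- by a maximal `f₀ ∈ g T₀` keeps it non-zero, and independence keeps it away from all other
  -- covers involved. It is thus a point of the smaller product but not of `ε T₀`.
  · obtain ⟨f₀, hf₀, hm⟩ := hX.exists_mem_inf_ne_bot he (hgR T₀ hT₀) hB0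
      (le_infBelow_iff.1 le_rfl).1
    have hf₀0 : f₀ ≠ ⊥ := fun h => hm (by rw [h, inf_bot_eq])
    have hT₀B : T₀ ∉ B := fun h => (hBC h).1 rfl
    have hm' : infBelow e (insert T₀ B) (Function.update η T₀ f₀) = infBelow e B η ⊓ f₀ := by
      unfold infBelow
      rw [Finset.fold_insert hT₀B, Function.update_self, inf_comm]
      congr 1
      exact Finset.fold_congr fun T hT => Function.update_of_ne (hBC hT).1 _ _
    have hins {T : Finset X.Next} (hT : T ∈ insert T₀ B) : T ∈ C := by
      rcases Finset.mem_insert.1 hT with rfl | hT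
      · exact hT₀
      · exact (hBC hT).2.1
    have key {F : Finset X.E} (hF : F ∈ X.R e) (hFs : ∀ T ∈ insert T₀ B, g T ≠ F) :
        ∀ f ∈ F, ¬ infBelow e B η ⊓ f₀ ≤ f := by
      intro f hf
      rw [← hm'] at hm ⊢
      refine hX.not_infBelow_le_of_injOn he (hginj.mono fun T hT => hins hT)
        (fun T hT => hgR T (hins hT)) ?_ hF hFs hm hf
      intro T hT
      by_cases hTT : T = T₀
      · subst hTT
        rw [Function.update_self]
        exact mem_supp_join_of_maximal hf₀ hf₀0
      · rw [Function.update_of_ne hTT]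
        have hTB := Finset.mem_of_mem_insert_of_ne hT hTT
        exact hη T (hBC hTB).2.1 (hBC hTB).2.2
    have hmy := (hchi _ hm).2 ⟨inf_le_left,
      fun F hF => key (hSR hF) fun T hT h => hgS T (hins hT) (by rwa [h]),
      fun T hT hTP => key (hgR T (Finset.mem_of_mem_erase hT)) fun T' hT' h => by
        have hTT' := hginj (hins hT') (Finset.mem_of_mem_erase hT) h
        subst hTT'
        rcases Finset.mem_insert.1 hT' with h' | h'
        · exact Finset.ne_of_mem_erase hT h'
        · exact (hBC h').2.2 hTP⟩
    have hmT₀ := next_le_iff_chi.1 hle _ hm hmy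
    rw [hT₀P, chi_prodElt_eq_one] at hmT₀
    exact hmT₀.2 (g T₀) (Finset.mem_insert_self _ _) f₀ hf₀.1 inf_le_right
  -- The product over `B` is itself a point: being below no `f` passes upwards from `m₀`. It then
  -- lies below `η T₀`, hence below an element of `g T₀`, contradicting independence.
  · have hBy := (hchi _ hB0).2 ⟨le_rfl, fun F hF f hf h => hm₀S F hF f hf (hm₀B.trans h),
      fun T hT hTP f hf h => hm₀A T hT hTP f hf (hm₀B.trans h)⟩
    have hBT₀ := next_le_iff_chi.1 hle _ hB0 hBy
    rw [hηε T₀ hT₀ hT₀P, chi_of_mul_prodElt_eq_one] at hBT₀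
    obtain ⟨f, hf, hηf⟩ := exists_le_of_mem_supp_join (hη T₀ hT₀ hT₀P)
    refine hX.not_infBelow_le_of_injOn he (hginj.mono fun T hT => (hBC hT).2.1)
      (fun T hT => hgR T (hBC hT).2.1) (fun T hT => hη T (hBC hT).2.1 (hBC hT).2.2)
      (hgR T₀ hT₀) ?_ hB0 hf (hBT₀.1.trans hηf)
    intro T hT h
    exact (hBC hT).1 (hginj (hBC hT).2.1 hT₀ h)

theorem next (hX : X.Admissible) : X.next.Admissible where
  isFiniteCover _ _ _ hT := hX.isFiniteCover_next hT
  cond_i _ _ _ _ hxy _ hT := hX.cond_i_next hxy hT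
  cond_ii _ hx _ hC _ hε _ hT₀ h0 := hX.cond_ii_next hx hC hε hT₀ h0

theorem iter (hX : X.Admissible) : ∀ k, (X.iter k).Admissible
  | 0 => hX
  | k + 1 => (hX.iter k).next

end Admissible
end CoverSystem

theorem SemigroupRing.lift_eq_sum {E : Type u} [SemilatticeInf E] [OrderBot E] {A : Type w}
    [NonUnitalCommRing A] (f : E → A) (h0 : f ⊥ = 0) (hmul : ∀ d e, f (d ⊓ e) = f d * f e)
    (x : SemigroupRing E) : lift f h0 hmul x = (coeff x).sum fun e n => n • f e :=
  liftAdd_apply f x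

namespace CoverSystem

variable {Γ : Type v} [Group Γ] {X : CoverSystem.{u, v} Γ}

/-! ### The image of `ℤ[E(E, ℛ)^×] → ℤ[E^×]` -/

/-- The homomorphism `nextHom`, as a map on `ℤ[E(E, ℛ)^×]`. -/
def inclHom (X : CoverSystem.{u, v} Γ) : SemigroupRing X.Next →ₙ+* SemigroupRing X.E :=
  lift X.incl X.incl_bot X.incl_inf

/-- The ideal of relations of the derived system, as an ideal of `ℤ[E(E, ℛ)^×]`. -/
def nextRelIdeal (X : CoverSystem.{u, v} Γ) : TwoSidedIdeal (SemigroupRing X.Next) :=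
  TwoSidedIdeal.span {x | ∃ t, t ≠ ⊥ ∧ ∃ T ∈ X.nextR t, x = of t - join T}

theorem inclHom_of (t : X.Next) : X.inclHom (of t) = X.incl t := lift_of _ _ _ t

theorem proj_eq_zero_iff {x : SemigroupRing X.E} : X.proj x = 0 ↔ x ∈ X.relIdeal := by
  rw [TwoSidedIdeal.mem_iff]
  exact RingCon.eq _

theorem proj_surjective : Function.Surjective X.proj := by
  rintro ⟨x⟩
  exact ⟨x, rfl⟩

theorem prodElt_mem_relIdeal {e : X.E} (he : e ≠ ⊥) {S : Finset (Finset X.E)} (hS : S.Nonempty)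
    (hSR : (S : Set (Finset X.E)) ⊆ X.R e) : prodElt e S ∈ X.relIdeal := by
  classical
  obtain ⟨G, hG⟩ := hS
  have h : prodElt e S = (of e - join G) * prodElt e S := by
    refine ext_chi fun m hm => ?_
    rw [map_mul, map_sub, chi_of, chi_join, chi_prodElt]
    by_cases hh : m ≤ e ∧ ∀ F ∈ S, ∀ f ∈ F, ¬ m ≤ f
    · rw [if_pos hh, if_pos hh.1, if_neg, sub_zero, one_mul]
      rintro ⟨f, hf, hmf⟩
      exact hh.2 G hG f hf hmf
    · rw [if_neg hh, mul_zero]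
  rw [h]
  exact X.relIdeal.mul_mem_right _ _ (TwoSidedIdeal.subset_span ⟨e, he, G, hSR hG, rfl⟩)

namespace Admissible

theorem inclHom_mem_relIdeal (hX : X.Admissible) (y : SemigroupRing X.Next) :
    X.inclHom y ∈ X.relIdeal := by
  induction y using induction_of with
  | h0 => rw [map_zero]; exact X.relIdeal.zero_mem
  | hadd a b ha hb => rw [map_add]; exact X.relIdeal.add_mem ha hb
  | hneg a ha => rw [map_neg]; exact X.relIdeal.neg_mem ha
  | hof t =>
    rw [inclHom_of]
    rcases hX.incl_mem_nextSet t with ⟨e, he, S, hS, hSR, h⟩ | h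
    · rw [h]
      exact prodElt_mem_relIdeal he hS hSR
    · rw [Set.mem_singleton_iff.1 h]
      exact X.relIdeal.zero_mem

/-- `E(E, ℛ)` is stable under multiplication by elements of `E`, so the image is an ideal and not
merely a subring. -/
theorem mul_inclHom_mem_range (hX : X.Admissible) (x : SemigroupRing X.E)
    (y : SemigroupRing X.Next) : ∃ z, X.inclHom z = x * X.inclHom y := by
  induction x using induction_of with
  | h0 => exact ⟨0, by rw [map_zero, zero_mul]⟩
  | hadd a b ha hb =>
    obtain ⟨z, hz⟩ := ha
    obtain ⟨z', hz'⟩ := hb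
    exact ⟨z + z', by rw [map_add, hz, hz', add_mul]⟩
  | hneg a ha =>
    obtain ⟨z, hz⟩ := ha
    exact ⟨-z, by rw [map_neg, hz, neg_mul]⟩
  | hof d =>
    induction y using induction_of with
    | h0 => exact ⟨0, by rw [map_zero, mul_zero]⟩
    | hadd a b ha hb =>
      obtain ⟨z, hz⟩ := ha
      obtain ⟨z', hz'⟩ := hb
      exact ⟨z + z', by rw [map_add, map_add, hz, hz', mul_add]⟩
    | hneg a ha =>
      obtain ⟨z, hz⟩ := ha
      exact ⟨-z, by rw [map_neg, map_neg, hz, mul_neg]⟩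
    | hof t =>
      exact ⟨of (hX.smulNext t d), by rw [inclHom_of, inclHom_of, incl_smulNext]⟩

theorem mem_relIdeal_iff (hX : X.Admissible) {x : SemigroupRing X.E} :
    x ∈ X.relIdeal ↔ ∃ y, X.inclHom y = x := by
  classical
  refine ⟨fun h => ?_, ?_⟩
  · induction h using TwoSidedIdeal.span_induction with
    | mem x hx =>
      obtain ⟨e, he, F, hF, rfl⟩ := hx
      obtain ⟨t, ht⟩ := hX.exists_next_eq (x := prodElt e {F})
        (Or.inl ⟨e, he, {F}, Finset.singleton_nonempty F, by simpa using hF, rfl⟩)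
      refine ⟨of t, ?_⟩
      rw [inclHom_of, ht]
      refine ext_chi fun m hm => ?_
      rw [map_sub, chi_of, chi_join, chi_prodElt]
      by_cases h1 : ∃ f ∈ F, m ≤ f
      · obtain ⟨f, hf, hmf⟩ := h1
        have hme := hmf.trans ((hX.isFiniteCover e he F hF).1 f hf).2
        rw [if_pos hme, if_pos (show ∃ f ∈ F, m ≤ f from ⟨f, hf, hmf⟩), if_neg, sub_self]
        exact fun hh => hh.2 F (Finset.mem_singleton_self F) f hf hmf
      · rw [if_neg h1, sub_zero]
        refine if_congr (and_iff_left ?_) rfl rfl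
        intro F' hF' f hf hmf
        rw [Finset.mem_singleton.1 hF'] at hf
        exact h1 ⟨f, hf, hmf⟩
    | zero => exact ⟨0, map_zero _⟩
    | add x y _ _ hx hy =>
      obtain ⟨z, rfl⟩ := hx
      obtain ⟨z', rfl⟩ := hy
      exact ⟨z + z', map_add _ _ _⟩
    | neg x _ hx =>
      obtain ⟨z, rfl⟩ := hx
      exact ⟨-z, map_neg _ _⟩
    | left_absorb a x _ hx =>
      obtain ⟨z, rfl⟩ := hx
      exact hX.mul_inclHom_mem_range a z
    | right_absorb b x _ hx =>
      obtain ⟨z, rfl⟩ := hx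
      rw [mul_comm]
      exact hX.mul_inclHom_mem_range b z
  · rintro ⟨y, rfl⟩
    exact hX.inclHom_mem_relIdeal y

/-! ### The kernel of `ℤ[E(E, ℛ)^×] → ℤ[E^×]` -/

theorem exists_cover (hX : X.Admissible) {e : X.E} (he : e ≠ ⊥) {S : Finset (Finset X.E)}
    (hS : S.Nonempty) (hSR : (S : Set (Finset X.E)) ⊆ X.R e) {G : Finset X.E} (hG : G ∈ X.R e) :
    ∃ T : Finset X.Next, X.incl '' (T : Set X.Next) = X.nextCover e S G := by
  have hfin : (X.nextCover e S G).Finite := by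
    refine (Set.finite_singleton _).union
      ((G.finite_toSet.image fun f => of f * prodElt e S).subset ?_)
    rintro _ ⟨-, f, hf, rfl⟩
    exact ⟨f, hf, rfl⟩
  refine ⟨(hfin.preimage X.incl_injective.injOn).toFinset, ?_⟩
  rw [Set.Finite.coe_toFinset, Set.image_preimage_eq_of_subset]
  intro x hx
  exact hX.exists_next_eq (hX.nextCover_subset he hS hSR hG hx)

theorem inclHom_smulHom (hX : X.Admissible) (x : X.Next) (z : SemigroupRing X.E) :
    X.inclHom (hX.smulHom x z) = z * X.incl x := by
  induction z using induction_of with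
  | h0 => rw [map_zero, map_zero, zero_mul]
  | hadd a b ha hb => rw [map_add, map_add, ha, hb, add_mul]
  | hneg a ha => rw [map_neg, map_neg, ha, neg_mul]
  | hof d => rw [smulHom_of, inclHom_of, incl_smulNext]

/-- Pointwise, a relation says that a point of `e(S)` lies either below some element of `G` or below
none: `e(S) = e(S ∪ {G}) + (⋁ G) · e(S)`. -/
theorem inclHom_eq_zero (hX : X.Admissible) {y : SemigroupRing X.Next}
    (hy : y ∈ X.nextRelIdeal) : X.inclHom y = 0 := by
  classical
  induction hy using TwoSidedIdeal.span_induction with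
  | mem x hx =>
    obtain ⟨x, hx0, T, hT, rfl⟩ := hx
    obtain ⟨e, he, S, hS, hSR, G, hG, hGS, hxS, hT⟩ := hT
    obtain ⟨a, ha⟩ := hX.exists_next_eq (prodElt_insert_mem_nextSet he hSR hG)
    have hj : join T = of a + hX.smulHom x (join G) := hX.join_cover he hSR hxS hG ha hT
    rw [map_sub, sub_eq_zero, hj, map_add, inclHom_of, inclHom_of, inclHom_smulHom, ha, hxS]
    refine ext_chi fun m hm => ?_
    rw [map_add, map_mul, chi_prodElt, chi_prodElt, chi_join]
    simp only [Finset.forall_mem_insert]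
    by_cases h1 : ∃ f ∈ G, m ≤ f
    · have hneg : ¬ (m ≤ e ∧ (∀ f ∈ G, ¬ m ≤ f) ∧ ∀ F ∈ S, ∀ f ∈ F, ¬ m ≤ f) := by
        obtain ⟨f, hf, hmf⟩ := h1
        exact fun hh => hh.2.1 f hf hmf
      rw [if_pos h1, one_mul, if_neg hneg, zero_add]
    · rw [if_neg h1, zero_mul, add_zero]
      push Not at h1
      refine if_congr (and_congr_right' ?_) rfl rfl
      exact (and_iff_right h1).symm
  | zero => exact map_zero _
  | add x y _ _ hx hy => rw [map_add, hx, hy, add_zero]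
  | neg x _ hx => rw [map_neg, hx, neg_zero]
  | left_absorb a x _ hx => rw [map_mul, hx, mul_zero]
  | right_absorb b x _ hx => rw [map_mul, hx, zero_mul]

/-- If for each `e` at most one of the elements `e(𝒮)` occurs in `w`, then `w` is determined by
its image in `ℤ[E^×]`. -/
theorem eq_zero_of_inclHom_eq_zero (hX : X.Admissible) {T : X.E → Finset (Finset X.E)}
    (hT : ∀ e, (T e : Set (Finset X.E)) ⊆ X.R e) {w : SemigroupRing X.Next}
    (hw : supp w ⊆ {t | ∃ e, e ≠ ⊥ ∧ X.incl t = prodElt e (T e)}) (h0 : X.inclHom w = 0) :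
    w = 0 := by
  by_contra hne
  have hw' : ∀ t ∈ supp w, ∃ e, e ≠ ⊥ ∧ X.incl t = prodElt e (T e) := hw
  choose! top htop htopT using hw'
  -- The character at a maximal top element vanishes on every other term: a term on which it is 1
  -- has a top element above `top t₀`, hence equal to it, and the top element determines the term.
  obtain ⟨t₀, ht₀, hmax⟩ := (supp_finite w).exists_maximalFor top _ (supp_nonempty hne)
  have hm := htop t₀ ht₀
  have h1 : chi (top t₀) hm (X.inclHom w) = coeff w ⟨t₀, ht₀.1⟩ := by
    have h2 : X.inclHom w = (coeff w).sum fun t n => n • X.incl t.1 := lift_eq_sum _ _ _ w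
    rw [h2, Finsupp.sum, map_sum, Finset.sum_eq_single ⟨t₀, ht₀.1⟩]
    · rw [map_zsmul, htopT t₀ ht₀, hX.chi_self_prodElt hm (hT _), smul_eq_mul, mul_one]
    · rintro ⟨t, ht⟩ htw htt₀
      have hts : t ∈ supp w := ⟨ht, by simpa using htw⟩
      rw [map_zsmul, htopT t hts]
      rcases chi_incl t hm with h | h
      · rw [← htopT t hts, h, smul_zero]
      · exfalso
        rw [htopT t hts, chi_prodElt_eq_one] at h
        have htop_eq := le_antisymm h.1 (hmax hts h.1)
        refine htt₀ (Subtype.ext (X.incl_injective ?_))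
        change X.incl t = X.incl t₀
        rw [htopT t hts, htopT t₀ ht₀, htop_eq]
    · intro h
      rw [Finsupp.notMem_support_iff.1 h, zero_smul, map_zero]
  rw [h0, map_zero] at h1
  exact ht₀.2 h1.symm

open Classical in
/-- Let `N` be a subgroup of `ℤ[E(E, ℛ)^×]` which contains the relations, `M ⊆ E` finite and closed
under multiplication, and `T e ⊆ ℛ(e)` the set of all covers contained in `M`. If `N` contains all
`e(T e)`, then it contains all `e(𝒮)` with `e ∈ M` and `𝒮 ⊆ T e`. -/
theorem of_mem_of_relIdeal_le (hX : X.Admissible) {M : Set X.E} (hM : M.Finite)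
    (hMinf : InfClosed M) {T : X.E → Finset (Finset X.E)}
    (hT : ∀ e F, F ∈ T e ↔ F ∈ X.R e ∧ (F : Set X.E) ⊆ M)
    {N : AddSubgroup (SemigroupRing X.Next)} (hN : ∀ y, y ∈ X.nextRelIdeal → y ∈ N)
    (hNT : ∀ e ∈ M, e ≠ ⊥ → ∀ t, X.incl t = prodElt e (T e) → of t ∈ N) {e : X.E} (heM : e ∈ M)
    (he : e ≠ ⊥) {S : Finset (Finset X.E)} (hS : S.Nonempty) (hST : S ⊆ T e) {t : X.Next}
    (ht : X.incl t = prodElt e S) : of t ∈ N := by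
  have hTR (e : X.E) {S : Finset (Finset X.E)} (hST : S ⊆ T e) :
      (S : Set (Finset X.E)) ⊆ X.R e := fun F hF => ((hT e F).1 (hST hF)).1
  suffices h : ∀ e ∈ M, e ≠ ⊥ → ∀ S : Finset (Finset X.E), S.Nonempty → S ⊆ T e →
      ∀ t, X.incl t = prodElt e S → of t ∈ N from h e heM he S hS hST t ht
  clear! e S t
  intro e heM
  -- Induction over the finite set `M`: the error terms of each reduction have strictly smaller top
  -- elements.
  refine (hM.wellFoundedOn (r := (· < ·))).induction heM (P := fun e => e ≠ ⊥ →
    ∀ S : Finset (Finset X.E), S.Nonempty → S ⊆ T e → ∀ t, X.incl t = prodElt e S → of t ∈ N) ?_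
  clear! e
  intro e heM ih he S hS hST t ht
  -- Modulo `N`, the covers of `T e` may be adjoined to `S` one at a time.
  have step : ∀ U : Finset (Finset X.E), U ⊆ T e → ∀ t', X.incl t' = prodElt e (S ∪ U) →
      of t - of t' ∈ N := by
    intro U
    induction U using Finset.induction_on with
    | empty =>
      intro _ t' ht'
      rw [Finset.union_empty, ← ht] at ht'
      rw [X.incl_injective ht', sub_self]
      exact zero_mem _
    | insert G U hGU ihU =>
      intro hU t' ht'
      have hUT := (Finset.subset_insert G U).trans hU
      have hGT := hU (Finset.mem_insert_self G U)
      have hG := ((hT e G).1 hGT).1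
      have hSU : S ∪ U ⊆ T e := Finset.union_subset hST hUT
      have hSU0 : (S ∪ U).Nonempty := hS.mono Finset.subset_union_left
      obtain ⟨t'', ht''⟩ := hX.exists_next_eq
        (x := prodElt e (S ∪ U)) (Or.inl ⟨e, he, _, hSU0, hTR e hSU, rfl⟩)
      have h1 := ihU hUT t'' ht''
      rw [Finset.union_insert] at ht'
      by_cases hGS : G ∈ S ∪ U
      · rw [Finset.insert_eq_of_mem hGS, ← ht''] at ht'
        rwa [X.incl_injective ht']
      · obtain ⟨C, hC⟩ := hX.exists_cover he hSU0 (hTR e hSU) hG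
        have hrel : of t'' - join C ∈ N := by
          refine hN _ (TwoSidedIdeal.subset_span ⟨t'', ?_, C, ?_, rfl⟩)
          · rintro rfl
            exact hX.prodElt_ne_zero he (hTR e hSU) ht''.symm
          · exact ⟨e, he, _, hSU0, hTR e hSU, G, hG, hGS, ht'', hC⟩
        -- Each term of `join G` is a product `d` of elements of `G`, so `d ∈ M` and `d < e`. Its
        -- covers `mulCover d F` again consist of elements of `M`, so the induction hypothesis
        -- applies.
        have hlow : hX.smulHom t'' (join G) ∈ N := by
          unfold join
          rw [map_sum]
          refine sum_mem fun J hJ => ?_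
          split_ifs with hJ0
          swap
          · rw [map_zero]
            exact zero_mem _
          rw [map_zsmul, smulHom_of]
          refine zsmul_mem ?_ _
          set d := J.inf' hJ0 id
          by_cases hd0 : hX.smulNext t'' d = ⊥
          · rw [hd0, of_bot]
            exact zero_mem _
          have hJG := Finset.mem_powerset.1 hJ
          have hdM : d ∈ M := hMinf.finsetInf'_mem hJ0 fun f hf => ((hT e G).1 hGT).2 (hJG hf)
          have hde : d < e := by
            obtain ⟨f, hf⟩ := hJ0
            have hdf : d ≤ f := Finset.inf'_le id hf
            refine lt_of_le_not_ge (hdf.trans ((hX.isFiniteCover e he G hG).1 f (hJG hf)).2)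
              fun hed => hX.not_le_of_mem he hG (hJG hf) (hed.trans hdf)
          have hincl : X.incl (hX.smulNext t'' d) = of d * prodElt e (S ∪ U) := by
            rw [incl_smulNext, ht'']
          obtain ⟨h2, h3⟩ := hX.image_mulCover_subset he (hTR e hSU) (d := d) (by
            rw [← hincl]
            exact fun h => hd0 (X.incl_injective h))
          rw [inf_eq_left.2 hde.le] at h2 h3
          rw [of_mul_prodElt, inf_eq_left.2 hde.le] at hincl
          refine ih d hdM hde h2 _ (hSU0.image _) ?_ _ hincl
          intro F' hF'
          refine (hT d F').2 ⟨h3 hF', ?_⟩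
          rw [Finset.mem_image] at hF'
          obtain ⟨F, hF, rfl⟩ := hF'
          intro x hx
          obtain ⟨-, f, hf, rfl⟩ := mem_mulCover.1 (Finset.mem_coe.1 hx)
          exact hMinf hdM (((hT e F).1 (hSU hF)).2 hf)
        rw [hX.join_cover he (hTR e hSU) ht'' hG ht' hC] at hrel
        have h4 := add_mem (add_mem h1 hrel) hlow
        convert h4 using 1
        abel
  obtain ⟨t', ht'⟩ := hX.exists_next_eq (x := prodElt e (T e))
    (Or.inl ⟨e, he, _, hS.mono hST, hTR e subset_rfl, rfl⟩)
  have h := step (T e) subset_rfl t' (by rw [Finset.union_eq_right.2 hST, ht'])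
  have h' := add_mem h (hNT e heM he t' ht')
  rwa [sub_add_cancel] at h'

/-- Modulo relations, `y` reduces to a combination `w` of the elements `e(T e)`. Relations map to 0,
so `w` is in the kernel too, and linear independence forces `w = 0`. -/
theorem mem_relIdeal_of_inclHom_eq_zero (hX : X.Admissible) {y : SemigroupRing X.Next}
    (hy : X.inclHom y = 0) : y ∈ X.nextRelIdeal := by
  classical
  have hex : ∀ t ∈ supp y, ∃ e, e ≠ ⊥ ∧ ∃ S : Finset (Finset X.E), S.Nonempty ∧
      (S : Set (Finset X.E)) ⊆ X.R e ∧ X.incl t = prodElt e S :=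
    fun t ht => hX.exists_incl_eq_prodElt ht.1
  choose! e he S hS hSR heS using hex
  -- `M` contains every top element and cover element occurring in `y`. It stays finite under
  -- closure, so each `T e` is finite, and closure under products keeps the reduction inside `M`.
  set M : Set X.E := infClosure
    (⋃ t ∈ supp y, insert (e t) (⋃ F ∈ S t, (F : Set X.E))) with hMdef
  have hM : M.Finite := by
    refine Set.Finite.infClosure ((supp_finite y).biUnion fun t _ => Set.Finite.insert _ ?_)
    exact (S t).finite_toSet.biUnion fun F _ => F.finite_toSet
  have hfin (e : X.E) : {F : Finset X.E | F ∈ X.R e ∧ (F : Set X.E) ⊆ M}.Finite :=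
    (hM.finite_subsets.preimage Finset.coe_injective.injOn).subset fun F hF => hF.2
  set T : X.E → Finset (Finset X.E) := fun e => (hfin e).toFinset
  have hT : ∀ e F, F ∈ T e ↔ F ∈ X.R e ∧ (F : Set X.E) ⊆ M := fun e F =>
    (hfin e).mem_toFinset
  set A : Set X.Next := {t | ∃ e, e ≠ ⊥ ∧ X.incl t = prodElt e (T e)}
  let K : AddSubgroup (SemigroupRing X.Next) :=
    { carrier := {z | z ∈ X.nextRelIdeal}
      zero_mem' := X.nextRelIdeal.zero_mem
      add_mem' := fun ha hb => X.nextRelIdeal.add_mem ha hb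
      neg_mem' := fun ha => X.nextRelIdeal.neg_mem ha }
  set W : AddSubgroup (SemigroupRing X.Next) := AddSubgroup.closure (of '' A)
  have hyN : y ∈ W ⊔ K := by
    have h1 : y ∈ AddSubgroup.closure (of '' supp y) := supp_subset_iff_mem_closure.1 subset_rfl
    refine (AddSubgroup.closure_le _).2 ?_ h1
    rintro _ ⟨t, ht, rfl⟩
    have hsub : insert (e t) (⋃ F ∈ S t, (F : Set X.E)) ⊆ M :=
      (Set.subset_biUnion_of_mem (u := fun t => insert (e t) (⋃ F ∈ S t, (F : Set X.E)))
        ht).trans subset_infClosure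
    refine hX.of_mem_of_relIdeal_le hM infClosed_infClosure hT ?_ ?_
      (hsub (Set.mem_insert _ _)) (he t ht) (hS t ht) ?_ (heS t ht)
    · intro z hz
      exact AddSubgroup.mem_sup_right (show z ∈ K from hz)
    · intro e _ he t ht
      exact AddSubgroup.mem_sup_left
        (AddSubgroup.subset_closure (Set.mem_image_of_mem of ⟨e, he, ht⟩))
    · intro F hF
      refine (hT _ F).2 ⟨hSR t ht hF, ?_⟩
      exact (Set.subset_biUnion_of_mem (u := fun F : Finset X.E => (F : Set X.E))
        (Finset.mem_coe.2 hF)).trans ((Set.subset_insert _ _).trans hsub)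
  obtain ⟨w, hw, z, hz, rfl⟩ := AddSubgroup.mem_sup.1 hyN
  have hw0 : w = 0 := by
    refine hX.eq_zero_of_inclHom_eq_zero (T := T) (fun e F hF => ((hT e F).1 hF).1)
      (supp_subset_iff_mem_closure.2 hw) ?_
    rwa [map_add, hX.inclHom_eq_zero hz, add_zero] at hy
  rw [hw0, zero_add]
  exact hz

end Admissible
end CoverSystem

namespace CoverSystem

variable {Γ : Type v} [Group Γ] {X : CoverSystem.{u, v} Γ}

/-! ### Exactness of the sequence -/

namespace Admissible

theorem exact_nextHom_proj (hX : X.Admissible) : Function.Exact X.nextHom X.proj :=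
  fun _ => proj_eq_zero_iff.trans hX.mem_relIdeal_iff

/-- The kernel is the relation ideal of the derived system, which is the image from the next level
by the image theorem applied to that system. -/
theorem exact_nextHom_nextHom (hX : X.Admissible) : Function.Exact X.next.nextHom X.nextHom :=
  fun y => (Iff.intro (fun h => hX.mem_relIdeal_of_inclHom_eq_zero h)
    (fun h => hX.inclHom_eq_zero h) : X.nextHom y = 0 ↔ y ∈ X.next.relIdeal).trans
      hX.next.mem_relIdeal_iff

end Admissible

/-! ### Equivariance, generation by idempotents -/

theorem inclHom_equivariant (g : Γ) (x : SemigroupRing X.Next) :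
    X.inclHom (mapAut (X.nextAction g) x) = X.ringAction g (X.inclHom x) := by
  induction x using induction_of with
  | h0 => rw [map_zero, map_zero, map_zero]
  | hadd a b ha hb => rw [map_add, map_add, map_add, map_add, ha, hb]
  | hneg a ha => rw [map_neg, map_neg, map_neg, map_neg, ha]
  | hof t => rw [mapAut_of, inclHom_of, inclHom_of, incl_nextAction]

theorem nextHom_equivariant (g : Γ) (x : SemigroupRing X.next.E) :
    X.nextHom (X.next.ringAction g x) = X.ringAction g (X.nextHom x) :=
  inclHom_equivariant g x

theorem closure_isIdempotentElem_quotRing :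
    NonUnitalSubring.closure {a : X.QuotRing | IsIdempotentElem a} = ⊤ := by
  rw [eq_top_iff]
  rintro a -
  obtain ⟨x, rfl⟩ := proj_surjective a
  induction x using induction_of with
  | h0 => rw [map_zero]; exact zero_mem _
  | hadd a b ha hb => rw [map_add]; exact add_mem ha hb
  | hneg a ha => rw [map_neg]; exact neg_mem ha
  | hof d =>
    refine NonUnitalSubring.subset_closure ?_
    change X.proj (of d) * X.proj (of d) = X.proj (of d)
    rw [← map_mul, of_mul_of, inf_idem]

theorem isIndependentResolution (hX : X.Admissible) :
    IsIndependentResolution X.quotAction (fun k => (X.iter k).toGSemilattice) X.proj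
      (fun k => (X.iter k).nextHom) where
  generated := closure_isIdempotentElem_quotRing
  aug_equivariant _ _ := rfl
  d_equivariant k := (X.iter k).nextHom_equivariant
  aug_surjective := proj_surjective
  exact_zero := hX.exact_nextHom_proj
  exact_succ k := (hX.iter k).exact_nextHom_nextHom

/-! ### The number of covers and the length of the resolution -/

/-- A derived cover of `e(S)` comes from some `G ∈ ℛ(e) \ S` and is determined by it. Since `S` is
non-empty, this is a proper subset of the finite set `ℛ(e)`. -/
theorem Admissible.encard_nextR_lt (hX : X.Admissible) {e : X.E} (he : e ≠ ⊥)
    (hfin : (X.R e).Finite) {S : Finset (Finset X.E)} (hS : S.Nonempty)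
    (hSR : (S : Set (Finset X.E)) ⊆ X.R e) {x : X.Next} (hx : X.incl x = prodElt e S) :
    (X.nextR x).encard < (X.R e).encard := by
  have hex : ∀ T ∈ X.nextR x, ∃ G ∈ X.R e, G ∉ S ∧
      X.incl '' (T : Set X.Next) = X.nextCover e S G :=
    fun T hT => (hX.mem_nextR_iff he hS hSR hx).1 hT
  choose! g hgR hgS hg using hex
  have h1 : (X.nextR x).encard ≤ (X.R e \ S).encard := by
    refine Set.encard_le_encard_of_injOn (f := g) (fun T hT => ⟨hgR T hT, hgS T hT⟩) ?_
    intro T hT T' hT' h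
    have := (hg T hT).trans ((congrArg (X.nextCover e S) h).trans (hg T' hT').symm)
    exact Finset.coe_injective (X.incl_injective.image_injective this)
  refine h1.trans_lt (hfin.sdiff.encard_lt_encard ?_)
  obtain ⟨F, hF⟩ := hS
  exact ⟨Set.sdiff_subset, fun h => (h (hSR hF)).2 hF⟩

/-- Each level costs at least one cover. The inductive bound also supplies the finiteness that makes
the next decrease strict. -/
theorem encard_R_add_le (hX : X.Admissible) (hfin : X.supCard < ⊤) (k : ℕ)
    {e : (X.iter k).E} (he : e ≠ ⊥) : ((X.iter k).R e).encard + k ≤ X.supCard := by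
  induction k with
  | zero =>
    rw [Nat.cast_zero, add_zero]
    exact le_iSup (fun e : {e : X.E // e ≠ ⊥} => (X.R e).encard) ⟨e, he⟩
  | succ k ih =>
    obtain ⟨d, hd, S, hS, hSR, h⟩ := (hX.iter k).exists_incl_eq_prodElt he
    have hdfin : ((X.iter k).R d).Finite :=
      Set.encard_lt_top_iff.1 ((le_self_add.trans (ih hd)).trans_lt hfin)
    have hlt := (hX.iter k).encard_nextR_lt hd hdfin hS hSR h
    have h1 : (((X.iter k).nextR e).encard + 1) + k ≤ X.supCard :=
      (add_le_add_left (Order.add_one_le_of_lt hlt) _).trans (ih hd)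
    rw [Nat.cast_succ, add_comm (k : ℕ∞), ← add_assoc]
    exact h1

theorem finite_R (hX : X.Admissible) (hfin : X.supCard < ⊤) (k : ℕ) {e : (X.iter k).E}
    (he : e ≠ ⊥) : ((X.iter k).R e).Finite :=
  Set.encard_lt_top_iff.1 ((le_self_add.trans (encard_R_add_le hX hfin k he)).trans_lt hfin)

theorem resolutionLength_le (hX : X.Admissible) (hfin : X.supCard < ⊤) :
    resolutionLength (fun k => (X.iter k).toGSemilattice) ≤ X.supCard := by
  obtain ⟨n, hn⟩ := ENat.ne_top_iff_exists.1 hfin.ne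
  rw [← hn]
  -- With `n` the supremum, a non-zero element of `E_{n+1}` would give `n + 1 ≤ n`.
  refine iInf₂_le n fun x => ?_
  by_contra hx
  have h := encard_R_add_le hX hfin (n + 1) hx
  rw [← hn] at h
  have h1 : ((n + 1 : ℕ) : ℕ∞) ≤ n := le_add_self.trans h
  exact absurd (Nat.cast_le.1 h1) (by simp)

end CoverSystem
end

/-! ### The main theorem -/

theorem mainTheorem3 {Γ : Type v} [Group Γ] (X : CoverSystem.{u, v} Γ) (hX : X.Admissible)
    (hfin : X.supCard < ⊤) :
    (∀ k, (X.iter k).Admissible ∧ (X.iter k).WellDefined) ∧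
    (∀ k, ∀ e : (X.iter k).E, e ≠ ⊥ → ∀ S : Finset (Finset (X.iter k).E), S.Nonempty →
      (S : Set (Finset (X.iter k).E)) ⊆ (X.iter k).R e →
      ∀ e' : (X.iter (k + 1)).E, (X.iter k).incl e' = SemigroupRing.prodElt e S →
      ((X.iter (k + 1)).R e').encard < ((X.iter k).R e).encard) ∧
    IsIndependentResolution X.quotAction (fun k => (X.iter k).toGSemilattice) X.proj
      (fun k => (X.iter k).nextHom) ∧
    resolutionLength (fun k => (X.iter k).toGSemilattice) ≤ X.supCard :=
  ⟨fun k => ⟨hX.iter k, (hX.iter k).wellDefined⟩,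
    fun k _ he _ hS hSR _ h =>
      (hX.iter k).encard_nextR_lt he (CoverSystem.finite_R hX hfin k he) hS hSR h,
    CoverSystem.isIndependentResolution hX, CoverSystem.resolutionLength_le hX hfin⟩
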